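/- \textbf{Definitions.} A \emph{family} in a set $X$ is a function $i\mapsto x_i\in X$ on a countable index set $I$; two families that differ by a bijection of index sets are the same. Let $\Sigma$ be a partial function from families in $X$ to $X$; a family is \emph{summable} if $\Sigma$ is defined on it. $(X,\Sigma)$ is a \emph{weak $\Sigma$-monoid} if: (1) every one-element family $\{x\}$ is summable with sum $x$; (2) the empty family is summable, with sum denoted $0$, and deleting all terms equal to $0$ from a summable family leaves a summable family; (3) (bracketing) if $\{\mathbf x_j\}_{j\in J}$ is a countable collection of finite summable families and $\Sigma\biguplus_j\mathbf x_j$ is defined with value $x$, then $\Sigma\{\Sigma\mathbf x_j\}_{j\in J}$ is defined with value $x$; (4) (flattening) if $J$ is finite, each $\mathbf x_j$ is summable and $\Sigma\{\Sigma\mathbf x_j\}_{j\in J}$ is defined with value $x$, then $\Sigma\biguplus_j\mathbf x_j$ is defined with value $x$. It is \emph{strong} if moreover every subfamily of a summable family is summable, (3) holds for arbitrary (countable) summable $\mathbf x_j$, and (4) holds for arbitrary countable $J$. It is \emph{finitely total} if every finite family is summable. It is a \emph{$\Sigma$-group} if it is finitely total and there is a map $x\mapsto -x$ with $\Sigma\{x,-x\}=0$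 for all $x$ that is a $\Sigma$-homomorphism. A function $f:X\to Y$ is a \emph{$\Sigma$-homomorphism} if, whenever $\{x_i\}$ is summable with sum $x$, $\{f(x_i)\}$ is summable with sum $f(x)$. A function $f:X\times Y\to Z$ is \emph{$\Sigma$-bilinear} if all $f(x,-)$ and $f(-,y)$ are $\Sigma$-homomorphisms. Let $\mathcal C$ be any one of the four categories of weak, strong, finitely total $\Sigma$-monoids or $\Sigma$-groups, with $\Sigma$-homomorphisms as morphisms. A \emph{tensor product} of $X,Y\in\mathcal C$ is an object $X\otimes Y\in\mathcal C$ with a $\Sigma$-bilinear function $p:X\times Y\to X\otimes Y$ such that for every $W\in\mathcal C$ every $\Sigma$-bilinear $f:X\times Y\to W$ equals $g\circ p$ for a unique $\Sigma$-homomorphism $g:X\otimes Y\to W$. Let $I=\{0,1\},\{0,1\},\mathbb N,\mathbb Z$ in the weak, strong, finitely total and group case respectively, where a family is summable iff it has only finitely many nonzero terms and their usual sum lies in $I$, and that is then its sum. For $n\in I$ and $x\in X$ let $n\cdot x$ be the sum of the family of $n$ copies of $x$ (of $|n|$ copies of $-x$ if $n<0$). \textbf{Theorem.} For each of the four categories $\mathcal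 C$: (a) Any two objects $X,Y$ of $\mathcal C$ have a tensor product in $\mathcal C$. (b) For $X,Y\in\mathcal C$, the set $[X,Y]$ of $\Sigma$-homomorphisms $X\to Y$ is an object of $\mathcal C$ under the pointwise partial sum: $\{f_i\}$ is summable with sum $g\in[X,Y]$ iff, for every $x\in X$, $\{f_i(x)\}$ is summable in $Y$ with sum $g(x)$. (c) For every choice of tensor products $(X\otimes Y,p)$ for all pairs of objects, $\mathcal C$ is a closed symmetric monoidal category with monoidal product $\otimes$, unit $I$ and internal hom $[-,-]$, whose structure satisfies $(f\otimes g)(p(x,y))=p(f(x),g(y))$, $\lambda(p(n,x))=n\cdot x$, $\rho(p(x,n))=n\cdot x$ (in particular these sums are defined), $\alpha(p(p(x,y),z))=p(x,p(y,z))$ and $\beta(p(x,y))=p(y,x)$, and whose evaluation $X\otimes[X,Y]\to Y$ satisfies $p(x,h)\mapsto h(x)$. -/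

import Mathlib

open CategoryTheory MonoidalCategory

universe u

namespace SigmaMonoid

/-! ### Partial infinitary sums and the four flavours of `Σ`-monoids -/

/-- The partial value determined by a predicate that holds of at most one element. -/
noncomputable def partOf {X : Type*} (P : X → Prop) : Part X :=
  ⟨∃ x, P x, fun h => h.choose⟩

theorem mem_partOf {X : Type*} {P : X → Prop} (hP : ∀ x y, P x → P y → x = y) {x : X} :
    x ∈ partOf P ↔ P x := by
  constructor
  · rintro ⟨h, rfl⟩
    exact h.choose_spec
  · intro h
    exact ⟨⟨x, h⟩, hP _ _ (Exists.choose_spec (⟨x, h⟩ : ∃ x, P x)) h⟩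

/-- A partial function `Σ` on the countable families of elements of `X`. Families are functions
on a countable index type, and two families that differ by a bijection of the index types are the
same family, so `Σ` has to take equal (partial) values on them.
`x ∈ sum f` says that `f` is summable with sum `x`; `(sum f).Dom` says that `f` is summable. -/
class PartialSum (X : Type u) where
  sum : ∀ {ι : Type} [Countable ι], (ι → X) → Part X
  sum_reindex : ∀ {ι κ : Type} [Countable ι] [Countable κ] (e : ι ≃ κ) (f : κ → X),
    sum (fun i => f (e i)) = sum f

open PartialSum (sum)

/-- `z` is the sum of the empty family. -/
def IsZero {X : Type u} [PartialSum X] (z : X) : Prop :=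
  z ∈ sum (fun i : Empty => (i.elim : X))

/-- `x'` is an inverse of `x`: the family `{x, x'}` is summable and its sum is the zero. -/
def IsNeg {X : Type u} [PartialSum X] (x x' : X) : Prop :=
  ∃ z : X, IsZero z ∧ z ∈ sum ![x, x']

/-- `Σ`-homomorphism condition. -/
def IsSigmaHom {X Y : Type u} [PartialSum X] [PartialSum Y] (f : X → Y) : Prop :=
  ∀ {ι : Type} [Countable ι] (a : ι → X) (x : X), x ∈ sum a → f x ∈ sum (fun i => f (a i))

/-- Weak `Σ`-monoids. A disjoint union of families is indexed by a `Sigma` type. -/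
structure IsWeak (X : Type u) [PartialSum X] : Prop where
  singleton : ∀ x : X, x ∈ sum (fun _ : Unit => x)
  neutral : ∃ z : X, IsZero z ∧
    ∀ {ι : Type} [Countable ι] (f : ι → X), (sum f).Dom →
      (sum (fun i : {i : ι // f i ≠ z} => f i)).Dom
  bracketing : ∀ {J : Type} [Countable J] {K : J → Type} [∀ j, Finite (K j)]
    (f : (Σ j, K j) → X) (s : J → X), (∀ j, s j ∈ sum (fun k : K j => f ⟨j, k⟩)) →
      ∀ x : X, x ∈ sum f → x ∈ sum s
  flattening : ∀ {J : Type} [Finite J] {K : J → Type} [∀ j, Countable (K j)]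
    (f : (Σ j, K j) → X) (s : J → X), (∀ j, s j ∈ sum (fun k : K j => f ⟨j, k⟩)) →
      ∀ x : X, x ∈ sum s → x ∈ sum f

/-- Strong `Σ`-monoids. -/
structure IsStrong (X : Type u) [PartialSum X] : Prop extends IsWeak X where
  subsummability : ∀ {ι : Type} [Countable ι] (f : ι → X), (sum f).Dom →
    ∀ J : Set ι, (sum (fun j : J => f j)).Dom
  strong_bracketing : ∀ {J : Type} [Countable J] {K : J → Type} [∀ j, Countable (K j)]
    (f : (Σ j, K j) → X) (s : J → X), (∀ j, s j ∈ sum (fun k : K j => f ⟨j, k⟩)) →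
      ∀ x : X, x ∈ sum f → x ∈ sum s
  strong_flattening : ∀ {J : Type} [Countable J] {K : J → Type} [∀ j, Countable (K j)]
    (f : (Σ j, K j) → X) (s : J → X), (∀ j, s j ∈ sum (fun k : K j => f ⟨j, k⟩)) →
      ∀ x : X, x ∈ sum s → x ∈ sum f

/-- Finitely total `Σ`-monoids. -/
structure IsFinitelyTotal (X : Type u) [PartialSum X] : Prop extends IsWeak X where
  summable_of_finite : ∀ {ι : Type} [Finite ι] (f : ι → X), (sum f).Dom

/-- `Σ`-groups. -/
structure IsSigmaGroup (X : Type u) [PartialSum X] : Prop extends IsFinitelyTotal X where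
  exists_neg : ∃ neg : X → X, (∀ x, IsNeg x (neg x)) ∧ IsSigmaHom neg

/-- The four flavours of `Σ`-monoids. -/
inductive Flavour
  | weak
  | strong
  | finitelyTotal
  | group

/-- `X` with its partial sum is a `Σ`-monoid of the given flavour. -/
def Flavour.Holds (k : Flavour) (X : Type u) [PartialSum X] : Prop :=
  match k with
  | .weak => IsWeak X
  | .strong => IsStrong X
  | .finitelyTotal => IsFinitelyTotal X
  | .group => IsSigmaGroup X

/-! ### The categories -/

/-- Objects: `Σ`-monoids of flavour `k`. -/
structure SCat (k : Flavour) where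
  carrier : Type u
  [partialSum : PartialSum carrier]
  holds : k.Holds carrier

instance (k : Flavour) : CoeSort (SCat.{u} k) (Type u) := ⟨SCat.carrier⟩

instance {k : Flavour} (X : SCat.{u} k) : PartialSum X := X.partialSum

/-- `Σ`-homomorphisms. -/
@[ext]
structure SigmaHom (X Y : Type u) [PartialSum X] [PartialSum Y] where
  toFun : X → Y
  isSigmaHom : IsSigmaHom toFun

instance {X Y : Type u} [PartialSum X] [PartialSum Y] : FunLike (SigmaHom X Y) X Y where
  coe := SigmaHom.toFun
  coe_injective _ _ h := SigmaHom.ext h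

instance (k : Flavour) : Category.{u} (SCat.{u} k) where
  Hom X Y := SigmaHom X Y
  id X := ⟨fun x => x, fun _ _ h => h⟩
  comp f g := ⟨fun x => g.toFun (f.toFun x), fun a x h => g.isSigmaHom _ _ (f.isSigmaHom a x h)⟩

instance (k : Flavour) : ConcreteCategory (SCat.{u} k) (fun X Y => SigmaHom X Y) where
  hom f := f
  ofHom f := f

/-! ### `Σ`-bilinear functions and tensor products -/

/-- `Σ`-bilinear functions `X × Y → Z`. -/
structure SigmaBilinear (X Y Z : Type u) [PartialSum X] [PartialSum Y] [PartialSum Z] where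
  toFun : X → Y → Z
  isSigmaHom_right : ∀ x, IsSigmaHom (fun y => toFun x y)
  isSigmaHom_left : ∀ y, IsSigmaHom (fun x => toFun x y)

instance {X Y Z : Type u} [PartialSum X] [PartialSum Y] [PartialSum Z] :
    CoeFun (SigmaBilinear X Y Z) (fun _ => X → Y → Z) := ⟨SigmaBilinear.toFun⟩

/-- An object of the category together with a `Σ`-bilinear function from `X × Y` to it. -/
structure BilinearFrom {k : Flavour} (X Y : SCat.{u} k) where
  obj : SCat.{u} k
  map : SigmaBilinear X Y obj

/-- `T` is a tensor product of `X` and `Y`: every `Σ`-bilinear function on `X × Y` with values in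
an object of the category factors through `T` by a unique `Σ`-homomorphism. -/
def BilinearFrom.IsTensorProduct {k : Flavour} {X Y : SCat.{u} k} (T : BilinearFrom X Y) : Prop :=
  ∀ (W : SCat.{u} k) (f : SigmaBilinear X Y W),
    ∃! g : T.obj ⟶ W, ∀ (x : X) (y : Y), g (T.map x y) = f x y

/-! ### The pointwise partial sum on `Σ`-homomorphisms -/

/-- `F` is summable with sum `g` iff, at each `x`, the family `F i x` is summable with sum
`g x`. -/
noncomputable instance homSum {X Y : Type u} [PartialSum X] [PartialSum Y] :
    PartialSum (SigmaHom X Y) where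
  sum F := partOf fun g : SigmaHom X Y => ∀ x, g x ∈ sum (fun i => F i x)
  sum_reindex e F := by
    congr 1
    funext g
    exact propext (forall_congr' fun x => by
      rw [PartialSum.sum_reindex e (fun i => F i x)])

theorem mem_homSum {X Y : Type u} [PartialSum X] [PartialSum Y] {ι : Type} [Countable ι]
    (F : ι → SigmaHom X Y) (g : SigmaHom X Y) :
    g ∈ sum F ↔ ∀ x, g x ∈ sum (fun i => F i x) :=
  mem_partOf fun _ _ h h' => DFunLike.ext _ _ fun x => Part.mem_unique (h x) (h' x)

/-- The `Σ`-homomorphisms `X → Y` with the pointwise partial sum, as an object, given that they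
form a `Σ`-monoid of the right flavour. -/
noncomputable def homObj {k : Flavour} (X Y : SCat.{u} k) (h : k.Holds (SigmaHom X Y)) :
    SCat.{u} k :=
  ⟨SigmaHom X Y, h⟩

/-! ### The tensor units -/

/-- The underlying set of the tensor unit: `{0, 1}`, `{0, 1}`, `ℕ` or `ℤ`. -/
def Flavour.unitSet : Flavour → Set ℤ
  | .weak => {0, 1}
  | .strong => {0, 1}
  | .finitelyTotal => {n | 0 ≤ n}
  | .group => Set.univ

/-- The finitely supported family `f` of integers has sum `m`. -/
def FinSum {ι : Type} (f : ι → ℤ) (m : ℤ) : Prop :=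
  f.support.Finite ∧ ∑ᶠ i, f i = m

theorem FinSum.unique {ι : Type} {f : ι → ℤ} {m n : ℤ} (h : FinSum f m) (h' : FinSum f n) :
    m = n := h.2.symm.trans h'.2

theorem finSum_reindex {ι κ : Type} (e : ι ≃ κ) (f : κ → ℤ) (m : ℤ) :
    FinSum (fun i => f (e i)) m ↔ FinSum f m := by
  have h1 : (fun i => f (e i)).support.Finite ↔ f.support.Finite := by
    constructor
    · intro h
      refine (h.image e).subset fun k hk => ⟨e.symm k, ?_, by simp⟩
      simpa using hk
    · intro h
      exact h.preimage e.injective.injOn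
  unfold FinSum
  rw [h1, finsum_comp_equiv e]

theorem finSum_singleton {ι : Type} [Unique ι] (m : ℤ) : FinSum (fun _ : ι => m) m :=
  ⟨Set.toFinite _, by rw [finsum_unique]⟩

theorem finSum_empty {ι : Type} [IsEmpty ι] (f : ι → ℤ) : FinSum f 0 :=
  ⟨Set.toFinite _, by rw [finsum_of_isEmpty]⟩

theorem FinSum.sub {ι : Type} {f : ι → ℤ} {m : ℤ} (h : FinSum f m) (s : Set ι) :
    FinSum (fun i : s => f i) (∑ᶠ i : s, f i) :=
  ⟨h.1.preimage Subtype.val_injective.injOn, rfl⟩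

/-- If `f` is finitely supported, so are its restrictions and the family of their sums, and the
total sums agree. -/
theorem finSum_bracketing {J : Type} {K : J → Type} (f : (Σ j, K j) → ℤ) (s : J → ℤ)
    (hs : ∀ j, FinSum (fun k => f ⟨j, k⟩) (s j)) {m : ℤ} (hf : FinSum f m) : FinSum s m := by
  classical
  obtain ⟨hf, rfl⟩ := hf
  have hJ : s.support ⊆ ((hf.image Sigma.fst).toFinset : Set J) := by
    intro j hj
    by_contra hc
    apply hj
    rw [← (hs j).2]
    have : (fun k => f ⟨j, k⟩) = fun _ => 0 := by
      funext k
      by_contra hk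
      exact hc (by simpa using ⟨_, hk⟩)
    rw [this, finsum_zero]
  refine ⟨(Finset.finite_toSet _).subset hJ, ?_⟩
  rw [finsum_eq_sum_of_support_subset s hJ]
  have key : ∀ j, s j = ∑ k ∈ (hs j).1.toFinset, f ⟨j, k⟩ := fun j => by
    exact (hs j).2.symm.trans
      (finsum_eq_sum_of_support_subset _ (Set.Finite.coe_toFinset (hs j).1).ge)
  simp_rw [key]
  rw [← Finset.sum_sigma (hf.image Sigma.fst).toFinset (fun j => (hs j).1.toFinset) f]
  symm
  apply finsum_eq_sum_of_support_subset
  rintro ⟨j, k⟩ hjk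
  simp only [Finset.coe_sigma, Set.mem_sigma_iff, Finset.mem_coe, Set.Finite.mem_toFinset,
    Set.mem_image]
  exact ⟨⟨⟨j, k⟩, hjk, rfl⟩, hjk⟩

/-- If only finitely many of the restrictions of `f` are not identically zero, and these are
finitely supported, then `f` is. -/
theorem finSum_flattening {J : Type} {K : J → Type} (f : (Σ j, K j) → ℤ) (s : J → ℤ)
    (hs : ∀ j, FinSum (fun k => f ⟨j, k⟩) (s j)) (hJ : {j | ∃ k, f ⟨j, k⟩ ≠ 0}.Finite)
    {m : ℤ} (hm : FinSum s m) : FinSum f m := by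
  have hf : f.support.Finite := by
    refine (hJ.biUnion fun j _ => (hs j).1.image (Sigma.mk j)).subset ?_
    rintro ⟨j, k⟩ hjk
    exact Set.mem_biUnion (x := j) ⟨k, hjk⟩ ⟨k, hjk, rfl⟩
  have := finSum_bracketing f s hs (m := ∑ᶠ i, f i) ⟨hf, rfl⟩
  exact ⟨hf, this.unique hm⟩

/-- The underlying type of the tensor unit, in an arbitrary universe. -/
abbrev UnitCarrier (k : Flavour) : Type u := ULift.{u} k.unitSet

/-- The integer that an element of the tensor unit is. -/
def UnitCarrier.val {k : Flavour} (n : UnitCarrier.{u} k) : ℤ := n.down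

theorem UnitCarrier.val_injective {k : Flavour} :
    Function.Injective (UnitCarrier.val : UnitCarrier.{u} k → ℤ) :=
  fun _ _ h => ULift.ext _ _ (Subtype.ext h)

/-- A family in the tensor unit is summable iff it has finitely many nonzero terms and their sum
lies in the underlying set; that sum is then its sum. -/
noncomputable instance unitSum (k : Flavour) : PartialSum (UnitCarrier.{u} k) where
  sum f := partOf fun n : UnitCarrier.{u} k => FinSum (fun i => (f i).val) n.val
  sum_reindex e f := by
    congr 1
    funext n
    exact propext (finSum_reindex e (fun i => (f i).val) n.val)

theorem mem_unitSum {k : Flavour} {ι : Type} [Countable ι] (f : ι → UnitCarrier.{u} k)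
    (n : UnitCarrier.{u} k) : n ∈ sum f ↔ FinSum (fun i => (f i).val) n.val :=
  mem_partOf fun _ _ h h' => UnitCarrier.val_injective (h.unique h')

theorem unitSum_dom {k : Flavour} {ι : Type} [Countable ι] (f : ι → UnitCarrier.{u} k) {m : ℤ}
    (hm : m ∈ k.unitSet) (h : FinSum (fun i => (f i).val) m) : (sum f).Dom :=
  ((mem_unitSum f ⟨⟨m, hm⟩⟩).2 h).1

theorem unit_isWeak (k : Flavour) : IsWeak (UnitCarrier.{u} k) where
  singleton x := (mem_unitSum _ _).2 (finSum_singleton _)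
  neutral := by
    have h0 : (0 : ℤ) ∈ k.unitSet := by cases k <;> simp [Flavour.unitSet]
    refine ⟨⟨⟨0, h0⟩⟩, (mem_unitSum _ _).2 (finSum_empty _), ?_⟩
    intro ι _ f hf
    obtain ⟨n, hn⟩ := Part.dom_iff_mem.1 hf
    rw [mem_unitSum] at hn
    refine unitSum_dom _ n.down.2 (m := n.val) ⟨(hn.sub _).1, ?_⟩
    rw [← hn.2]
    change ∑ᶠ i : ({i | f i ≠ ⟨⟨0, h0⟩⟩} : Set ι), (f i).val = _
    rw [finsum_subtype_eq_finsum_cond (f := fun i => (f i).val)]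
    refine finsum_congr fun i => ?_
    by_cases hi : f i = ⟨⟨0, h0⟩⟩
    · simp [hi, UnitCarrier.val]
    · simp [hi]
  bracketing f s hs x hx := by
    rw [mem_unitSum] at hx ⊢
    exact finSum_bracketing _ _ (fun j => (mem_unitSum _ _).1 (hs j)) hx
  flattening f s hs x hx := by
    rw [mem_unitSum] at hx ⊢
    exact finSum_flattening _ _ (fun j => (mem_unitSum _ _).1 (hs j)) (Set.toFinite _) hx

theorem unit_summable_of_finite {k : Flavour} (hk : k = .finitelyTotal ∨ k = .group)
    {ι : Type} [Finite ι] (f : ι → UnitCarrier.{u} k) : (sum f).Dom := by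
  refine unitSum_dom f (m := ∑ᶠ i, (f i).val) ?_ ⟨Set.toFinite _, rfl⟩
  rcases hk with rfl | rfl
  · exact finsum_nonneg (f := fun i => (f i).val) fun i => (f i).down.2
  · trivial

theorem unit_isStrong : IsStrong (UnitCarrier.{u} .strong) where
  toIsWeak := unit_isWeak _
  subsummability {ι} _ f hf J := by
    obtain ⟨n, hn⟩ := Part.dom_iff_mem.1 hf
    rw [mem_unitSum] at hn
    have h0 : ∀ i, 0 ≤ (f i).val := fun i => by
      have h : (f i).val = 0 ∨ (f i).val = 1 := (f i).down.2
      omega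
    refine unitSum_dom _ ?_ (hn.sub J)
    have h1 : 0 ≤ ∑ᶠ i : J, (f i).val := finsum_nonneg fun i => h0 i
    have h2 : ∑ᶠ i : J, (f i).val ≤ n.val := by
      obtain ⟨hn1, hn2⟩ := hn
      rw [← hn2, finsum_subtype_eq_finsum_cond (f := fun i => (f i).val) (· ∈ J)]
      have hle : ∀ i, ∑ᶠ _ : i ∈ J, (f i).val ≤ (f i).val := fun i => by
        by_cases hi : i ∈ J <;> simp [hi, h0]
      have hsub : (fun i => ∑ᶠ _ : i ∈ J, (f i).val).support ⊆ hn1.toFinset := by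
        intro i hi
        rw [Set.Finite.coe_toFinset]
        intro hz
        apply hi
        simp [hz]
      rw [finsum_eq_sum_of_support_subset _ hsub,
        finsum_eq_sum_of_support_subset _ (Set.Finite.coe_toFinset hn1).ge]
      exact Finset.sum_le_sum fun i _ => hle i
    have h3 : n.val ≤ 1 := by
      have h : n.val = 0 ∨ n.val = 1 := n.down.2
      omega
    change _ = _ ∨ _ = _
    omega
  strong_bracketing f s hs x hx := by
    rw [mem_unitSum] at hx ⊢
    exact finSum_bracketing _ _ (fun j => (mem_unitSum _ _).1 (hs j)) hx
  strong_flattening {J} _ {K} _ f s hs x hx := by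
    rw [mem_unitSum] at hx ⊢
    have h0 : ∀ i, 0 ≤ (f i).val := fun i => by
      have h : (f i).val = 0 ∨ (f i).val = 1 := (f i).down.2
      omega
    refine finSum_flattening _ _ (fun j => (mem_unitSum _ _).1 (hs j)) (hx.1.subset ?_) hx
    rintro j ⟨k, hk⟩ hz
    have hj := (mem_unitSum _ _).1 (hs j)
    have := single_le_finsum k hj.1 (fun k => h0 ⟨j, k⟩)
    rw [hj.2] at this
    change (s j).val = 0 at hz
    have := h0 ⟨j, k⟩
    omega

theorem unit_isFinitelyTotal : IsFinitelyTotal (UnitCarrier.{u} .finitelyTotal) where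
  toIsWeak := unit_isWeak _
  summable_of_finite f := unit_summable_of_finite (Or.inl rfl) f

theorem unit_isSigmaGroup : IsSigmaGroup (UnitCarrier.{u} .group) where
  toIsWeak := unit_isWeak _
  summable_of_finite f := unit_summable_of_finite (Or.inr rfl) f
  exists_neg := by
    refine ⟨fun n => ⟨⟨-n.val, trivial⟩⟩, fun n => ⟨⟨⟨0, trivial⟩⟩, ?_, ?_⟩, ?_⟩
    · exact (mem_unitSum _ _).2 (finSum_empty _)
    · rw [mem_unitSum]
      refine ⟨Set.toFinite _, ?_⟩
      rw [finsum_eq_sum_of_fintype, Fin.sum_univ_two]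
      simp [UnitCarrier.val]
    · intro ι _ a x hx
      rw [mem_unitSum] at hx ⊢
      refine ⟨hx.1.subset ?_, ?_⟩
      · intro i hi hz
        apply hi
        simpa [UnitCarrier.val] using hz
      · change ∑ᶠ i, -(a i).val = -x.val
        rw [finsum_neg_distrib, hx.2]

/-- The tensor unit. -/
noncomputable def unitObj : (k : Flavour) → SCat.{u} k
  | .weak => ⟨UnitCarrier.{u} .weak, unit_isWeak _⟩
  | .strong => ⟨UnitCarrier.{u} .strong, unit_isStrong⟩
  | .finitelyTotal => ⟨UnitCarrier.{u} .finitelyTotal, unit_isFinitelyTotal⟩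
  | .group => ⟨UnitCarrier.{u} .group, unit_isSigmaGroup⟩

/-- The integer that an element of the tensor unit is. -/
def unitVal : {k : Flavour} → unitObj.{u} k → ℤ
  | .weak => fun n => UnitCarrier.val n
  | .strong => fun n => UnitCarrier.val n
  | .finitelyTotal => fun n => UnitCarrier.val n
  | .group => fun n => UnitCarrier.val n

/-- `y` is the sum of the family of `n` copies of `x` if `n ≥ 0`, and of `|n|` copies of the
inverse of `x` if `n < 0`. -/
def IsMultiple {X : Type u} [PartialSum X] (n : ℤ) (x y : X) : Prop :=
  (0 ≤ n ∧ y ∈ sum (fun _ : Fin n.natAbs => x)) ∨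
    (n < 0 ∧ ∃ x' : X, IsNeg x x' ∧ y ∈ sum (fun _ : Fin n.natAbs => x'))

end SigmaMonoid

-- The internal hom and the tensor product carry partial sums of one kind: a family has sum `t`
-- exactly when its image under each of a jointly injective family of maps into `Σ`-monoids has the
-- image of `t` as sum (`IsInitialSum`). The maps are the evaluations for `[X, Y]`, and all
-- `Σ`-bilinear functions on `X × Y` for the tensor product. Axioms saying that a given element is a
-- sum are then checked at each map. What remains is to find elements: a zero, sums of subfamilies
-- or of finite families, negatives.
--
-- For `[X, Y]` a pointwise sum of homomorphisms must again be a homomorphism. This is an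
-- interchange of double sums, by flattening one way and bracketing the other
-- (`sigmaHom_subsummability`, `sigmaHom_summable_of_finite`). The tensor product is the part of the
-- product of all codomains of bilinear functions that pure tensors generate under partial sums. It
-- is small, because its elements are values of countably branching terms, and it contains every
-- componentwise sum of its families. Its projections are the required factorizations, and induction
-- on generation makes them unique (`isTensorProduct_tensor`).
--
-- Each `x` is the image of `1` under a homomorphism from the unit (`exists_sigmaHom_unit`). Taking
-- for `x` the identity in `[X, X]` gives a bilinear action of the unit on `X`, hence the unitors.
-- Since `n · x` is characterized by a property that homomorphisms preserve, the action commutes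
-- with all of them. The associator comes from currying trilinear functions into `[Z, W]`, and every
-- coherence law is checked on pure tensors. Evaluation and `y ↦ (x ↦ p(x, y))` are the counit and
-- unit of the tensor-hom adjunction.

universe v

namespace SigmaMonoid

open PartialSum (sum)

/-! ### Sums in weak `Σ`-monoids -/

section Basic

variable {X : Type u} [PartialSum X] {ι κ : Type} [Countable ι] [Countable κ]

theorem mem_sum_reindex (e : ι ≃ κ) {f : κ → X} {x : X} :
    x ∈ sum (fun i => f (e i)) ↔ x ∈ sum f := by
  rw [PartialSum.sum_reindex]

theorem isZero_iff [IsEmpty ι] (f : ι → X) {z : X} : IsZero z ↔ z ∈ sum f := by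
  rw [← mem_sum_reindex (Equiv.equivEmpty ι).symm, IsZero]
  exact iff_of_eq (congrArg (fun g : Empty → X => z ∈ sum g) (funext fun i => i.elim))

theorem IsZero.unique {x y : X} (hx : IsZero x) (hy : IsZero y) : x = y :=
  Part.mem_unique hx hy

theorem IsSigmaHom.map_isZero {Y : Type u} [PartialSum Y] {f : X → Y} (hf : IsSigmaHom f) {z : X}
    (hz : IsZero z) : IsZero (f z) :=
  (isZero_iff _).2 (hf _ _ hz)

theorem IsSigmaHom.map_isNeg {Y : Type u} [PartialSum Y] {f : X → Y} (hf : IsSigmaHom f) {x x' : X}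
    (h : IsNeg x x') : IsNeg (f x) (f x') := by
  obtain ⟨z, hz, h⟩ := h
  refine ⟨f z, hf.map_isZero hz, ?_⟩
  convert hf _ _ h using 2
  funext i
  fin_cases i <;> rfl

theorem IsSigmaHom.comp {Y Z : Type u} [PartialSum Y] [PartialSum Z] {g : Y → Z} {f : X → Y}
    (hg : IsSigmaHom g) (hf : IsSigmaHom f) : IsSigmaHom (fun x => g (f x)) :=
  fun _ _ h => hg _ _ (hf _ _ h)

theorem IsSigmaHom.map_isMultiple {Y : Type u} [PartialSum Y] {f : X → Y} (hf : IsSigmaHom f)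
    {n : ℤ} {x y : X} (h : IsMultiple n x y) : IsMultiple n (f x) (f y) := by
  rcases h with ⟨hn, h⟩ | ⟨hn, x', hx', h⟩
  · exact Or.inl ⟨hn, hf _ _ h⟩
  · exact Or.inr ⟨hn, f x', hf.map_isNeg hx', hf _ _ h⟩

theorem IsWeak.exists_isZero (h : IsWeak X) : ∃ z : X, IsZero z :=
  let ⟨z, hz, _⟩ := h.neutral
  ⟨z, hz⟩

theorem IsWeak.mem_sum_of_unique (h : IsWeak X) [Unique ι] (a : ι → X) : a default ∈ sum a := by
  rw [← mem_sum_reindex (Equiv.ofUnique Unit ι)]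
  convert h.singleton (a default) using 2
  exact funext fun i => congrArg a (Subsingleton.elim _ _)

/-- The neutral axiom only deletes zeros. Inserting them is an instance of bracketing, with a
one-element block at each index in `s` and an empty block, of sum `z`, at the others. -/
theorem IsWeak.mem_sum_of_mem_sum_restrict (h : IsWeak X) {z : X} (hz : IsZero z) (a : ι → X)
    (s : Set ι) (hs : ∀ i, i ∉ s → a i = z) {x : X} (hx : x ∈ sum (fun i : s => a i)) :
    x ∈ sum a := by
  let e : (Σ i, PLift (i ∈ s)) ≃ s :=
    ⟨fun p => ⟨p.1, p.2.down⟩, fun i => ⟨i.1, ⟨i.2⟩⟩, fun _ => rfl, fun _ => rfl⟩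
  refine h.bracketing (K := fun i => PLift (i ∈ s)) (fun p => a p.1) a (fun i => ?_) x
    ((mem_sum_reindex e (f := fun i : s => a i)).2 hx)
  by_cases hi : i ∈ s
  · have : Unique (PLift (i ∈ s)) := ⟨⟨⟨hi⟩⟩, fun _ => rfl⟩
    exact h.mem_sum_of_unique (fun _ : PLift (i ∈ s) => a i)
  · have : IsEmpty (PLift (i ∈ s)) := ⟨fun p => hi p.down⟩
    rw [hs i hi]
    exact (isZero_iff _).1 hz

/-- For the converse, delete all zeros and reinsert those indexed by `s`. The axiom does not give
the value of the reduced sum; reinserting all zeros shows that it is unchanged. -/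
theorem IsWeak.mem_sum_restrict_iff (h : IsWeak X) {z : X} (hz : IsZero z) (a : ι → X)
    (s : Set ι) (hs : ∀ i, i ∉ s → a i = z) {x : X} :
    x ∈ sum (fun i : s => a i) ↔ x ∈ sum a := by
  refine ⟨h.mem_sum_of_mem_sum_restrict hz a s hs, fun hx => ?_⟩
  obtain ⟨z', hz', hdel⟩ := h.neutral
  obtain rfl := hz.unique hz'
  obtain ⟨y, hy⟩ := Part.dom_iff_mem.1 (hdel a (Part.dom_iff_mem.2 ⟨x, hx⟩))
  have hxy : y = x := Part.mem_unique
    (h.mem_sum_of_mem_sum_restrict hz a {i | a i ≠ z} (fun i hi => by simpa using hi) hy) hx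
  subst hxy
  let e : ({i : s | a i ≠ z} : Set s) ≃ {i // a i ≠ z} :=
    ⟨fun i => ⟨i.1.1, i.2⟩, fun i => ⟨⟨i.1, by_contra fun hi => i.2 (hs _ hi)⟩, i.2⟩,
      fun _ => rfl, fun _ => rfl⟩
  exact h.mem_sum_of_mem_sum_restrict hz (fun i : s => a i) {i : s | a i ≠ z}
    (fun i hi => by simpa using hi)
    ((mem_sum_reindex e (f := fun i : {i // a i ≠ z} => a i)).2 hy)

theorem IsWeak.zeros_mem_sum (h : IsWeak X) {z : X} (hz : IsZero z) : z ∈ sum (fun _ : ι => z) :=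
  h.mem_sum_of_mem_sum_restrict hz (fun _ => z) ∅ (fun _ _ => rfl) ((isZero_iff _).1 hz)

theorem IsWeak.isSigmaHom_zero {Y : Type u} [PartialSum Y] (h : IsWeak X) {z : X} (hz : IsZero z) :
    IsSigmaHom (fun _ : Y => z) :=
  fun _ _ _ => h.zeros_mem_sum hz

theorem mem_sum_pair_iff {y z x : X} :
    x ∈ sum ![y, z] ↔ x ∈ sum (fun b : Bool => bif b then z else y) := by
  rw [← mem_sum_reindex finTwoEquiv.symm (f := ![y, z])]
  refine iff_of_eq (congrArg (fun g : Bool → X => x ∈ sum g) (funext fun b => ?_))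
  cases b <;> rfl

theorem IsWeak.mem_sum_sumType (h : IsWeak X) (a : ι ⊕ κ → X) {y z x : X}
    (hy : y ∈ sum (fun i => a (.inl i))) (hz : z ∈ sum (fun i => a (.inr i)))
    (hx : x ∈ sum ![y, z]) : x ∈ sum a := by
  rw [mem_sum_pair_iff] at hx
  have : ∀ b : Bool, Countable (bif b then κ else ι) := by rintro (_ | _) <;> assumption
  rw [← mem_sum_reindex (Equiv.sumEquivSigmaBool ι κ).symm]
  refine h.flattening _ _ (fun b => ?_) x hx
  cases b
  · exact hy
  · exact hz

/-- Bracketing into two blocks. Unlike flattening in `mem_sum_sumType`, it needs finite blocks in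
the weak case. -/
theorem IsWeak.mem_sum_pair (h : IsWeak X) [Finite ι] [Finite κ] (a : ι ⊕ κ → X) {y z x : X}
    (hy : y ∈ sum (fun i => a (.inl i))) (hz : z ∈ sum (fun i => a (.inr i)))
    (hx : x ∈ sum a) : x ∈ sum ![y, z] := by
  rw [mem_sum_pair_iff]
  have : ∀ b : Bool, Finite (bif b then κ else ι) := by rintro (_ | _) <;> assumption
  rw [← mem_sum_reindex (Equiv.sumEquivSigmaBool ι κ).symm] at hx
  refine h.bracketing _ _ (fun b => ?_) x hx
  cases b
  · exact hy
  · exact hz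

end Basic

/-! ### The monoid of finite sums -/

section FinitelyTotal

variable {X : Type u} [PartialSum X]

/-- The commutative monoid of finite sums in a finitely total `Σ`-monoid. -/
noncomputable abbrev IsFinitelyTotal.addCommMonoid (h : IsFinitelyTotal X) : AddCommMonoid X :=
  letI add : Add X := ⟨fun x y => (sum ![x, y]).get (h.summable_of_finite _)⟩
  letI zero : Zero X := ⟨h.exists_isZero.choose⟩
  have hz : IsZero (0 : X) := h.exists_isZero.choose_spec
  have hadd : ∀ x y : X, x + y ∈ sum ![x, y] := fun x y => Part.get_mem _
  have hcomm : ∀ x y : X, x + y = y + x := fun x y => by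
    refine Part.mem_unique (hadd x y) ?_
    rw [← mem_sum_reindex (Equiv.swap (0 : Fin 2) 1)]
    convert hadd y x using 2
    funext i
    fin_cases i <;> rfl
  have hzero : ∀ x : X, 0 + x = x := fun x => by
    refine Part.mem_unique (hadd 0 x) ?_
    refine h.mem_sum_pair (ι := Empty) (κ := Unit) (fun _ => x) ((isZero_iff _).1 hz)
      (h.singleton x) ?_
    rw [← mem_sum_reindex (Equiv.emptySum Empty Unit).symm]
    exact h.singleton x
  { add := (· + ·)
    zero := 0
    nsmul := nsmulRec
    add_comm := hcomm
    zero_add := hzero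
    add_zero := fun x => by rw [hcomm, hzero]
    add_assoc := fun x y z => by
      have hpair : ∀ (a : Unit ⊕ Unit → X), a (.inl ()) + a (.inr ()) ∈ sum a := fun a =>
        h.mem_sum_sumType a (h.mem_sum_of_unique fun i => a (.inl i))
          (h.mem_sum_of_unique fun i => a (.inr i)) (hadd _ _)
      -- Associativity: flatten `(x + y) + z` to the three-element family, reassociate the index
      -- type, and bracket as `x + (y + z)`.
      have h1 : (x + y) + z ∈ sum (Sum.elim (Sum.elim (fun _ : Unit => x) (fun _ : Unit => y))
          (fun _ : Unit => z)) :=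
        h.mem_sum_sumType _ (hpair (Sum.elim (fun _ => x) (fun _ => y))) (h.singleton z) (hadd _ _)
      rw [← mem_sum_reindex (Equiv.sumAssoc Unit Unit Unit).symm] at h1
      refine (Part.mem_unique (hadd x (y + z)) (h.mem_sum_pair _ (h.singleton x) ?_ h1)).symm
      have h2 : y + z ∈ sum (Sum.elim (fun _ : Unit => y) (fun _ : Unit => z)) := hpair _
      convert h2 using 2
      funext i
      rcases i with _ | _ <;> rfl }

theorem IsFinitelyTotal.isZero_zero (h : IsFinitelyTotal X) :
    letI := h.addCommMonoid
    IsZero (0 : X) :=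
  h.exists_isZero.choose_spec

theorem IsFinitelyTotal.add_mem_sum (h : IsFinitelyTotal X) (x y : X) :
    letI := h.addCommMonoid
    x + y ∈ sum ![x, y] :=
  Part.get_mem _

theorem IsFinitelyTotal.isNeg_iff (h : IsFinitelyTotal X) {x y : X} :
    letI := h.addCommMonoid
    IsNeg x y ↔ x + y = 0 := by
  let := h.addCommMonoid
  constructor
  · rintro ⟨z, hz, hxy⟩
    rw [← h.isZero_zero.unique hz] at hxy
    exact Part.mem_unique (h.add_mem_sum x y) hxy
  · intro hxy
    exact ⟨0, h.isZero_zero, hxy ▸ h.add_mem_sum x y⟩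

theorem IsFinitelyTotal.isNeg_unique (h : IsFinitelyTotal X) {x y z : X} (hy : IsNeg x y)
    (hz : IsNeg x z) : y = z := by
  let := h.addCommMonoid
  rw [h.isNeg_iff] at hy hz
  exact left_neg_eq_right_neg ((add_comm _ _).trans hy) hz

theorem IsFinitelyTotal.sum_univ_mem_sum (h : IsFinitelyTotal X) {ι : Type} [Fintype ι]
    (a : ι → X) :
    letI := h.addCommMonoid
    ∑ i, a i ∈ sum a := by
  let := h.addCommMonoid
  revert a
  refine Fintype.induction_empty_option (P := fun ι _ => ∀ a : ι → X, ∑ i, a i ∈ sum a)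
    ?_ ?_ ?_ ι
  · intro α β _ e ih a
    let := Fintype.ofEquiv β e.symm
    rw [← mem_sum_reindex e, ← e.sum_comp]
    exact ih _
  · intro a
    exact (isZero_iff _).1 (by simpa using h.isZero_zero)
  · intro α _ ih a
    rw [← mem_sum_reindex ((Equiv.optionEquivSumPUnit α).trans (Equiv.sumComm _ _)).symm,
      Fintype.sum_option]
    exact h.mem_sum_sumType _ (h.mem_sum_of_unique fun _ : PUnit => a none) (ih _)
      (h.add_mem_sum _ _)

theorem IsFinitelyTotal.finsum_mem_sum (h : IsFinitelyTotal X) {ι : Type} [Countable ι]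
    (a : ι → X) :
    letI := h.addCommMonoid
    a.support.Finite → ∑ᶠ i, a i ∈ sum a := by
  let := h.addCommMonoid
  intro ha
  let := ha.fintype
  refine h.mem_sum_of_mem_sum_restrict h.isZero_zero a a.support
    (fun i hi => by simpa using hi) ?_
  convert h.sum_univ_mem_sum (fun i : a.support => a i)
  rw [← finsum_eq_sum_of_fintype, finsum_subtype_eq_finsum_cond (f := a) (· ∈ a.support)]
  refine finsum_congr fun i => ?_
  by_cases hi : a i = 0 <;> simp [hi]

/-- The commutative group of finite sums in a `Σ`-group. -/
noncomputable abbrev IsSigmaGroup.addCommGroup (h : IsSigmaGroup X) : AddCommGroup X :=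
  -- The monoid part is definitionally the earlier one, so that the lemmas on finite sums apply to
  -- it.
  { h.toIsFinitelyTotal.addCommMonoid with
    neg := h.exists_neg.choose
    zsmul := @zsmulRec X h.toIsFinitelyTotal.addCommMonoid.toZero
      h.toIsFinitelyTotal.addCommMonoid.toAdd ⟨h.exists_neg.choose⟩
      (@nsmulRec X h.toIsFinitelyTotal.addCommMonoid.toZero
        h.toIsFinitelyTotal.addCommMonoid.toAdd)
    neg_add_cancel := fun x => by
      let := h.toIsFinitelyTotal.addCommMonoid
      exact (add_comm _ _).trans
        (h.toIsFinitelyTotal.isNeg_iff.1 (h.exists_neg.choose_spec.1 x)) }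

theorem IsMultiple.unique {n : ℤ} (h : 0 ≤ n ∨ IsFinitelyTotal X) {x y z : X}
    (hy : IsMultiple n x y) (hz : IsMultiple n x z) : y = z := by
  rcases hy with ⟨_, hy⟩ | ⟨hn, x', hx', hy⟩ <;> rcases hz with ⟨_, hz⟩ | ⟨_, x'', hx'', hz⟩
  · exact Part.mem_unique hy hz
  · omega
  · omega
  · rcases h with h | h
    · omega
    · obtain rfl := h.isNeg_unique hx' hx''
      exact Part.mem_unique hy hz

end FinitelyTotal

/-! ### Initial partial sums -/

/-- The partial sum on `T` is the one determined by the jointly injective maps `π i`. -/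
structure IsInitialSum {T : Type u} [PartialSum T] {I : Type v} {W : I → Type u}
    [∀ i, PartialSum (W i)] (π : ∀ i, T → W i) : Prop where
  injective : ∀ t t', (∀ i, π i t = π i t') → t = t'
  mem_sum_iff : ∀ {ι : Type} [Countable ι] (a : ι → T) (t : T),
    t ∈ sum a ↔ ∀ i, π i t ∈ sum (fun j => π i (a j))

namespace IsInitialSum

variable {T : Type u} [PartialSum T] {I : Type v} {W : I → Type u}
    [∀ i, PartialSum (W i)] {π : ∀ i, T → W i}

theorem isSigmaHom (h : IsInitialSum π) (i : I) : IsSigmaHom (π i) :=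
  fun _ _ ha => (h.mem_sum_iff _ _).1 ha i

theorem map_isZero (h : IsInitialSum π) {z : T} (hz : IsZero z) (i : I) : IsZero (π i z) :=
  IsSigmaHom.map_isZero (f := π i) (h.isSigmaHom i) hz

theorem isZero_of_forall (h : IsInitialSum π) {z : T} (hz : ∀ i, IsZero (π i z)) : IsZero z :=
  (h.mem_sum_iff _ _).2 fun i => (isZero_iff _).1 (hz i)

theorem isNeg_of_forall (h : IsInitialSum π) {z : T} (hz : IsZero z) {x y : T}
    (hxy : ∀ i, IsNeg (π i x) (π i y)) : IsNeg x y := by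
  refine ⟨z, hz, (h.mem_sum_iff _ _).2 fun i => ?_⟩
  obtain ⟨z', hz', hi⟩ := hxy i
  rw [← (h.map_isZero hz i).unique hz'] at hi
  convert hi using 2
  funext j
  fin_cases j <;> rfl

theorem isWeak (h : IsInitialSum π) (hW : ∀ i, IsWeak (W i)) (hz : ∃ z : T, IsZero z) :
    IsWeak T where
  singleton x := (h.mem_sum_iff _ _).2 fun i => (hW i).singleton _
  neutral := by
    obtain ⟨z, hz⟩ := hz
    refine ⟨z, hz, fun f hf => ?_⟩
    obtain ⟨x, hx⟩ := Part.dom_iff_mem.1 hf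
    rw [h.mem_sum_iff] at hx
    refine Part.dom_iff_mem.2 ⟨x, (h.mem_sum_iff _ _).2 fun i => ?_⟩
    -- Since `π i` can send nonzero elements to zero, the deleted terms are only some of the zeros
    -- in `W i`. Hence the version for an arbitrary set of indices.
    exact ((hW i).mem_sum_restrict_iff (h.map_isZero hz i) (fun j => π i (f j))
      {j | f j ≠ z} fun j hj => congrArg (π i) (by simpa using hj)).2 (hx i)
  bracketing f s hs x hx := by
    simp only [h.mem_sum_iff] at hs hx ⊢
    exact fun i => (hW i).bracketing (fun p => π i (f p)) _ (fun j => hs j i) _ (hx i)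
  flattening f s hs x hx := by
    simp only [h.mem_sum_iff] at hs hx ⊢
    exact fun i => (hW i).flattening (fun p => π i (f p)) _ (fun j => hs j i) _ (hx i)

/-- Subsummability asserts that a sum exists in `T`, which the coordinates alone do not provide; it
stays a hypothesis. -/
theorem isStrong (h : IsInitialSum π) (hW : ∀ i, IsStrong (W i)) (hz : ∃ z : T, IsZero z)
    (hsub : ∀ {ι : Type} [Countable ι] (f : ι → T), (sum f).Dom →
      ∀ J : Set ι, (sum (fun j : J => f j)).Dom) : IsStrong T where
  toIsWeak := h.isWeak (fun i => (hW i).toIsWeak) hz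
  subsummability := hsub
  strong_bracketing f s hs x hx := by
    simp only [h.mem_sum_iff] at hs hx ⊢
    exact fun i => (hW i).strong_bracketing (fun p => π i (f p)) _ (fun j => hs j i) _ (hx i)
  strong_flattening f s hs x hx := by
    simp only [h.mem_sum_iff] at hs hx ⊢
    exact fun i => (hW i).strong_flattening (fun p => π i (f p)) _ (fun j => hs j i) _ (hx i)

theorem isFinitelyTotal (h : IsInitialSum π) (hW : ∀ i, IsFinitelyTotal (W i))
    (hfin : ∀ {ι : Type} [Finite ι] (f : ι → T), (sum f).Dom) : IsFinitelyTotal T where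
  toIsWeak := h.isWeak (fun i => (hW i).toIsWeak)
    (Part.dom_iff_mem.1 (hfin fun i : Empty => (i.elim : T)))
  summable_of_finite := hfin

/-- Any choice of coordinatewise inverses will do: inverses in `W i` are unique, so each `π i`
carries the chosen negation to the one of `W i`, which is a homomorphism. -/
theorem isSigmaGroup (h : IsInitialSum π) (hW : ∀ i, IsSigmaGroup (W i))
    (hfin : ∀ {ι : Type} [Finite ι] (f : ι → T), (sum f).Dom)
    (hneg : ∀ t : T, ∃ t' : T, ∀ i, IsNeg (π i t) (π i t')) : IsSigmaGroup T where
  toIsFinitelyTotal := h.isFinitelyTotal (fun i => (hW i).toIsFinitelyTotal) hfin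
  exists_neg := by
    obtain ⟨z, hz⟩ := Part.dom_iff_mem.1 (hfin fun i : Empty => (i.elim : T))
    choose neg hneg using hneg
    refine ⟨neg, fun x => h.isNeg_of_forall hz (hneg x), fun a x hx => ?_⟩
    rw [h.mem_sum_iff] at hx ⊢
    intro i
    obtain ⟨negW, hnegW, hhom⟩ := (hW i).exists_neg
    have key : ∀ t, π i (neg t) = negW (π i t) := fun t =>
      (hW i).toIsFinitelyTotal.isNeg_unique (hneg t i) (hnegW _)
    simp only [key]
    exact hhom _ _ (hx i)

end IsInitialSum

theorem Flavour.Holds.isWeak {k : Flavour} {X : Type u} [PartialSum X] (h : k.Holds X) :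
    IsWeak X := by
  cases k
  · exact h
  · exact h.toIsWeak
  · exact h.toIsWeak
  · exact h.toIsWeak

/-! ### The internal hom -/

section Hom

variable {X Y : Type u} [PartialSum X] [PartialSum Y]

theorem isInitialSum_eval : IsInitialSum (fun (x : X) (f : SigmaHom X Y) => f x) where
  injective _ _ h := DFunLike.ext _ _ h
  mem_sum_iff := mem_homSum

theorem exists_isZero_sigmaHom (hY : IsWeak Y) : ∃ z : SigmaHom X Y, IsZero z := by
  obtain ⟨z, hz⟩ := hY.exists_isZero
  exact ⟨⟨fun _ => z, hY.isSigmaHom_zero hz⟩, isInitialSum_eval.isZero_of_forall fun _ => hz⟩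

theorem sigmaHom_subsummability (hY : IsStrong Y) {ι : Type} [Countable ι] (f : ι → SigmaHom X Y)
    (hf : (sum f).Dom) (J : Set ι) : (sum (fun j : J => f j)).Dom := by
  obtain ⟨g, hg⟩ := Part.dom_iff_mem.1 hf
  rw [mem_homSum] at hg
  have hJ : ∀ x, (sum (fun j : J => f j x)).Dom := fun x =>
    hY.subsummability (fun i => f i x) (Part.dom_iff_mem.2 ⟨_, hg x⟩) J
  choose h hh using fun x => Part.dom_iff_mem.1 (hJ x)
  refine Part.dom_iff_mem.2 ⟨⟨h, fun {κ} _ a x hx => ?_⟩, (mem_homSum _ _).2 hh⟩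
  -- The whole double family `f i (a k)` is summable, because its row sums `g (a k)` are. Its part
  -- with `i ∈ J` is then summable, and bracketing that part by `k` and by `i` gives the two sides
  -- of the homomorphism property of `h`.
  have hflat : g x ∈ sum (fun p : Σ _ : κ, ι => f p.2 (a p.1)) :=
    hY.strong_flattening (K := fun _ : κ => ι) (fun p => f p.2 (a p.1)) (fun k => g (a k))
      (fun k => hg (a k)) _ (g.isSigmaHom a x hx)
  have hsub := hY.subsummability _ (Part.dom_iff_mem.2 ⟨_, hflat⟩) {p | p.2 ∈ J}
  obtain ⟨y, hy⟩ := Part.dom_iff_mem.1 hsub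
  let e₁ : (Σ _ : κ, J) ≃ {p : Σ _ : κ, ι | p.2 ∈ J} :=
    ⟨fun p => ⟨⟨p.1, p.2.1⟩, p.2.2⟩, fun p => ⟨p.1.1, ⟨p.1.2, p.2⟩⟩, fun _ => rfl, fun _ => rfl⟩
  let e₂ : (Σ _ : J, κ) ≃ {p : Σ _ : κ, ι | p.2 ∈ J} :=
    ⟨fun p => ⟨⟨p.2, p.1.1⟩, p.1.2⟩, fun p => ⟨⟨p.1.2, p.2⟩, p.1.1⟩, fun _ => rfl, fun _ => rfl⟩
  have h₁ : y ∈ sum (fun k => h (a k)) :=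
    hY.strong_bracketing _ _ (fun k => hh (a k)) y ((mem_sum_reindex e₁).2 hy)
  have h₂ : y ∈ sum (fun j : J => f j x) :=
    hY.strong_bracketing _ _ (fun j : J => (f j).isSigmaHom a x hx) y ((mem_sum_reindex e₂).2 hy)
  rwa [Part.mem_unique (hh x) h₂]

/-- The same interchange of sums within the weak axioms: finiteness of `ι` permits flattening over
`ι` and then bracketing into blocks indexed by `ι`. -/
theorem sigmaHom_summable_of_finite (hY : IsFinitelyTotal Y) {ι : Type} [Finite ι]
    (f : ι → SigmaHom X Y) : (sum f).Dom := by
  choose h hh using fun x => Part.dom_iff_mem.1 (hY.summable_of_finite (fun i => f i x))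
  refine Part.dom_iff_mem.2 ⟨⟨h, fun {κ} _ a x hx => ?_⟩, (mem_homSum _ _).2 hh⟩
  have hflat : h x ∈ sum (fun p : Σ _ : ι, κ => f p.1 (a p.2)) :=
    hY.flattening (K := fun _ : ι => κ) (fun p => f p.1 (a p.2)) (fun i => f i x)
      (fun i => (f i).isSigmaHom a x hx) _ (hh x)
  let e : (Σ _ : κ, ι) ≃ (Σ _ : ι, κ) :=
    ⟨fun p => ⟨p.2, p.1⟩, fun p => ⟨p.2, p.1⟩, fun _ => rfl, fun _ => rfl⟩
  exact hY.bracketing _ _ (fun k => hh (a k)) _ ((mem_sum_reindex e).2 hflat)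

theorem holds_sigmaHom {k : Flavour} (hY : k.Holds Y) : k.Holds (SigmaHom X Y) := by
  have hz := exists_isZero_sigmaHom (X := X) hY.isWeak
  cases k
  · exact isInitialSum_eval.isWeak (fun _ => hY) hz
  · exact isInitialSum_eval.isStrong (fun _ => hY) hz (sigmaHom_subsummability hY)
  · exact isInitialSum_eval.isFinitelyTotal (fun _ => hY) (sigmaHom_summable_of_finite hY)
  · refine isInitialSum_eval.isSigmaGroup (fun _ => hY)
      (sigmaHom_summable_of_finite hY.toIsFinitelyTotal) fun f => ?_
    obtain ⟨neg, hneg, hhom⟩ := IsSigmaGroup.exists_neg hY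
    exact ⟨⟨fun x => neg (f x), hhom.comp f.isSigmaHom⟩, fun x => hneg (f x)⟩

end Hom

/-! ### Existence of tensor products -/

section Tensor

variable {k : Flavour} (X Y : SCat.{u} k)

/-- The elements of the product of all codomains of `Σ`-bilinear functions on `X × Y` that are
generated by the pure tensors under partial sums. -/
inductive IsTensor : (∀ q : BilinearFrom X Y, q.obj) → Prop
  | pure (x : X) (y : Y) : IsTensor (fun q => q.map x y)
  | sum {ι : Type} [Countable ι] (a : ι → ∀ q : BilinearFrom X Y, q.obj)
      (t : ∀ q : BilinearFrom X Y, q.obj) (ha : ∀ i, IsTensor (a i))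
      (ht : ∀ q, t q ∈ PartialSum.sum (fun i => a i q)) : IsTensor t

/-- Formal expressions for the elements generated by pure tensors. -/
inductive TensorTerm : Type u
  | pure (x : X) (y : Y) : TensorTerm
  | sum (s : Set ℕ) (a : s → TensorTerm) : TensorTerm

open Classical in
/-- The value of a formal expression, with an arbitrary value for undefined sums. -/
noncomputable def TensorTerm.eval (q : BilinearFrom X Y) : TensorTerm X Y → q.obj
  | .pure x y => q.map x y
  | .sum _ a =>
    if h : (PartialSum.sum (fun i => (a i).eval q)).Dom then
      (PartialSum.sum (fun i => (a i).eval q)).get h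
    else q.obj.holds.isWeak.exists_isZero.choose

theorem IsTensor.exists_term {t : ∀ q : BilinearFrom X Y, q.obj} (ht : IsTensor X Y t) :
    ∃ c : TensorTerm X Y, (fun q => c.eval X Y q) = t := by
  induction ht with
  | pure x y => exact ⟨.pure x y, rfl⟩
  | @sum ι _ a t _ ht ih =>
    choose c hc using ih
    -- Arbitrary countable index types are replaced by sets of natural numbers, the only arities
    -- that terms allow.
    obtain ⟨f, hf⟩ := exists_injective_nat ι
    let e := Equiv.ofInjective f hf
    refine ⟨.sum (Set.range f) fun n => c (e.symm n), funext fun q => ?_⟩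
    have key : t q ∈ PartialSum.sum (fun n => (c (e.symm n)).eval X Y q) := by
      rw [mem_sum_reindex e.symm (f := fun i => (c i).eval X Y q)]
      convert ht q using 2
      exact funext fun i => congrFun (hc i) q
    rw [TensorTerm.eval, dif_pos (Part.dom_iff_mem.2 ⟨_, key⟩)]
    exact Part.get_eq_of_mem key _

/-- The product over all bilinear functions lives in a larger universe. Its generated part is
covered by terms, which form a type in `u`. -/
instance small_isTensor : Small.{u} {t // IsTensor X Y t} :=
  small_subset (s := Set.range fun (c : TensorTerm X Y) q => c.eval X Y q)
    (t := {t | IsTensor X Y t})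
    fun _ ht => IsTensor.exists_term X Y ht

/-- The carrier of the tensor product. -/
def TensorCarrier : Type u := Shrink.{u} {t // IsTensor X Y t}

variable {X Y}

/-- The component of an element of the tensor product at a `Σ`-bilinear function. -/
noncomputable def TensorCarrier.proj (q : BilinearFrom X Y) (t : TensorCarrier X Y) : q.obj :=
  ((equivShrink _).symm t).1 q

/-- The element of the tensor product with given components. -/
noncomputable def TensorCarrier.mk (t : ∀ q : BilinearFrom X Y, q.obj) (ht : IsTensor X Y t) :
    TensorCarrier X Y :=
  equivShrink _ ⟨t, ht⟩

@[simp]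
theorem TensorCarrier.proj_mk (t : ∀ q : BilinearFrom X Y, q.obj) (ht : IsTensor X Y t)
    (q : BilinearFrom X Y) : (TensorCarrier.mk t ht).proj q = t q := by
  simp [proj, mk]

theorem TensorCarrier.ext {t t' : TensorCarrier X Y} (h : ∀ q, t.proj q = t'.proj q) : t = t' :=
  (equivShrink _).symm.injective (Subtype.ext (funext h))

theorem TensorCarrier.isTensor (t : TensorCarrier X Y) : IsTensor X Y (fun q => t.proj q) :=
  ((equivShrink _).symm t).2

noncomputable instance : PartialSum (TensorCarrier X Y) where
  sum a := partOf fun t => ∀ q, t.proj q ∈ sum (fun i => (a i).proj q)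
  sum_reindex e a := by
    congr 1
    funext t
    exact propext (forall_congr' fun q => mem_sum_reindex e (f := fun i => (a i).proj q))

theorem isInitialSum_proj :
    IsInitialSum (fun (q : BilinearFrom X Y) (t : TensorCarrier X Y) => t.proj q) where
  injective _ _ := TensorCarrier.ext
  mem_sum_iff _ _ := mem_partOf fun _ _ h h' =>
    TensorCarrier.ext fun q => Part.mem_unique (h q) (h' q)

/-- The family of component sums is itself generated by pure tensors. This reduces the summability
axioms of the tensor product to those of the codomains. -/
theorem TensorCarrier.summable {ι : Type} [Countable ι] (a : ι → TensorCarrier X Y)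
    (h : ∀ q, (sum (fun i => (a i).proj q)).Dom) : (sum a).Dom := by
  refine Part.dom_iff_mem.2 ⟨.mk (fun q => (sum (fun i => (a i).proj q)).get (h q))
    (.sum (fun i q => (a i).proj q) _ (fun i => (a i).isTensor) fun q => Part.get_mem _), ?_⟩
  rw [isInitialSum_proj.mem_sum_iff]
  intro q
  rw [proj_mk]
  exact Part.get_mem _

/-- Negate the first factor of a pure tensor. At a sum, use that negation is a homomorphism in each
codomain, where uniqueness identifies it with the inverses from the induction hypothesis. -/
theorem IsTensor.exists_neg {X Y : SCat.{u} .group} {t : ∀ q : BilinearFrom X Y, q.obj}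
    (ht : IsTensor X Y t) : ∃ t', IsTensor X Y t' ∧ ∀ q, IsNeg (t q) (t' q) := by
  induction ht with
  | pure x y =>
    obtain ⟨neg, hneg, _⟩ := IsSigmaGroup.exists_neg X.holds
    exact ⟨_, .pure (neg x) y, fun q =>
      IsSigmaHom.map_isNeg (f := fun x => q.map x y) (q.map.isSigmaHom_left y) (hneg x)⟩
  | sum a t _ ht ih =>
    choose a' ha' hneg' using ih
    choose neg hneg hhom using fun q : BilinearFrom X Y => IsSigmaGroup.exists_neg q.obj.holds
    refine ⟨fun q => neg q (t q), .sum a' _ ha' fun q => ?_, fun q => hneg q _⟩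
    have key : ∀ i, a' i q = neg q (a i q) := fun i =>
      (IsSigmaGroup.toIsFinitelyTotal q.obj.holds).isNeg_unique (hneg' i q) (hneg q _)
    simp only [key]
    exact hhom q _ _ (ht q)

variable (X Y) in
theorem TensorCarrier.holds : k.Holds (TensorCarrier X Y) := by
  have hz : ∃ z : TensorCarrier X Y, IsZero z :=
    Part.dom_iff_mem.1 (summable _ fun q =>
      let ⟨z, hz⟩ := q.obj.holds.isWeak.exists_isZero
      Part.dom_iff_mem.2 ⟨z, (isZero_iff _).1 hz⟩)
  cases k
  · exact isInitialSum_proj.isWeak (fun q => q.obj.holds) hz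
  · refine isInitialSum_proj.isStrong (fun q => q.obj.holds) hz fun f hf J =>
      summable _ fun q => IsStrong.subsummability q.obj.holds (fun i => (f i).proj q) ?_ J
    obtain ⟨x, hx⟩ := Part.dom_iff_mem.1 hf
    exact Part.dom_iff_mem.2 ⟨_, isInitialSum_proj.isSigmaHom q f x hx⟩
  · exact isInitialSum_proj.isFinitelyTotal (fun q => q.obj.holds) fun f =>
      summable f fun q => IsFinitelyTotal.summable_of_finite q.obj.holds _
  · refine isInitialSum_proj.isSigmaGroup (fun q => q.obj.holds) (fun f =>
      summable f fun q => (IsSigmaGroup.toIsFinitelyTotal q.obj.holds).summable_of_finite _)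
      fun t => ?_
    obtain ⟨t', ht', hneg⟩ := t.isTensor.exists_neg
    exact ⟨.mk t' ht', fun q => by simpa using hneg q⟩

variable (X Y) in
/-- The tensor product of `X` and `Y`. -/
noncomputable def tensor : BilinearFrom X Y where
  obj := ⟨TensorCarrier X Y, TensorCarrier.holds X Y⟩
  map :=
    { toFun := fun x y => TensorCarrier.mk _ (.pure x y)
      isSigmaHom_right := fun x _ _ a y hy => by
        refine (isInitialSum_proj.mem_sum_iff _ _).2 fun q => ?_
        simpa using q.map.isSigmaHom_right x a y hy
      isSigmaHom_left := fun y _ _ a x hx => by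
        refine (isInitialSum_proj.mem_sum_iff _ _).2 fun q => ?_
        simpa using q.map.isSigmaHom_left y a x hx }

theorem isTensorProduct_tensor : (tensor X Y).IsTensorProduct := by
  intro W f
  let q : BilinearFrom X Y := ⟨W, f⟩
  refine ⟨⟨fun t : TensorCarrier X Y => t.proj q, isInitialSum_proj.isSigmaHom q⟩,
    fun x y => TensorCarrier.proj_mk _ _ q, fun g hg => ?_⟩
  refine SigmaHom.ext (funext fun t : TensorCarrier X Y => ?_)
  -- Uniqueness by induction on generation: a generating sum is a sum in the tensor product, hence
  -- preserved by `g`.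
  have key : ∀ (t : ∀ q : BilinearFrom X Y, q.obj) (ht : IsTensor X Y t),
      g.toFun (TensorCarrier.mk t ht) = t q := by
    intro t ht
    induction ht with
    | pure x y => exact hg x y
    | sum a t ha ht ih =>
      refine Part.mem_unique (g.isSigmaHom (fun i => TensorCarrier.mk (a i) (ha i)) _
        ((isInitialSum_proj.mem_sum_iff _ _).2 fun q => ?_)) ?_
      · simpa using ht q
      · simpa only [ih] using ht q
  have ht : TensorCarrier.mk _ t.isTensor = t := TensorCarrier.ext fun q => by simp
  have := key _ t.isTensor
  rwa [ht] at this

end Tensor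

/-! ### The tensor unit represents elements -/

section Unit

/-- The element `1` of the tensor unit. -/
noncomputable def unitOne : (k : Flavour) → unitObj.{u} k
  | .weak => ⟨⟨1, Or.inr rfl⟩⟩
  | .strong => ⟨⟨1, Or.inr rfl⟩⟩
  | .finitelyTotal => ⟨⟨1, show (0 : ℤ) ≤ 1 from zero_le_one⟩⟩
  | .group => ⟨⟨1, trivial⟩⟩

theorem finSum_const {m : ℤ} (c : ℤ) : FinSum (fun _ : Fin m.natAbs => c) (m.natAbs * c) :=
  ⟨Set.toFinite _, by simp [finsum_eq_sum_of_fintype]⟩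

theorem unitVal_nonneg {k : Flavour} (hk : k ≠ .group) (n : unitObj.{u} k) : 0 ≤ unitVal n := by
  cases k
  · have h : unitVal n = 0 ∨ unitVal n = 1 := n.down.2
    omega
  · have h : unitVal n = 0 ∨ unitVal n = 1 := n.down.2
    omega
  · exact n.down.2
  · exact absurd rfl hk

theorem mem_sum_unitObj {k : Flavour} {ι : Type} [Countable ι] (a : ι → unitObj.{u} k)
    (n : unitObj.{u} k) : n ∈ sum a ↔ FinSum (fun i => unitVal (a i)) (unitVal n) := by
  cases k <;> exact mem_unitSum a n

theorem unitVal_unitOne (k : Flavour) : unitVal (unitOne.{u} k) = 1 := by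
  cases k <;> rfl

theorem isMultiple_unitOne {k : Flavour} (n : unitObj.{u} k) :
    IsMultiple (unitVal n) (unitOne k) n := by
  rcases le_or_gt 0 (unitVal n) with hn | hn
  · refine Or.inl ⟨hn, (mem_sum_unitObj _ _).2 ?_⟩
    convert finSum_const (unitVal (unitOne k)) using 1
    rw [unitVal_unitOne]
    omega
  · cases k
    case group =>
      let m : unitObj.{u} .group := ⟨⟨-1, trivial⟩⟩
      let z : unitObj.{u} .group := ⟨⟨0, trivial⟩⟩
      refine Or.inr ⟨hn, m, ⟨z, (mem_sum_unitObj _ _).2 (finSum_empty _), ?_⟩,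
        (mem_sum_unitObj _ _).2 ?_⟩
      · rw [mem_sum_unitObj]
        refine ⟨Set.toFinite _, ?_⟩
        rw [finsum_eq_sum_of_fintype, Fin.sum_univ_two]
        rfl
      · convert finSum_const (-1) using 1
        · rfl
        · omega
    all_goals exact absurd (unitVal_nonneg (by simp) n) (by omega)

theorem isMultiple_unique {k : Flavour} {W : SCat.{u} k} (n : unitObj.{u} k) {x y z : W}
    (hy : IsMultiple (unitVal n) x y) (hz : IsMultiple (unitVal n) x z) : y = z := by
  refine IsMultiple.unique ?_ hy hz
  cases k
  case group => exact Or.inr (IsSigmaGroup.toIsFinitelyTotal W.holds)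
  all_goals exact Or.inl (unitVal_nonneg (by simp) n)

/-- The blocks of `n i` copies of `x` together form `m` copies, so this is bracketing of one finite
constant family. Summing the constant `1` over the disjoint union counts its elements. -/
theorem IsWeak.sum_multiples {X : Type u} [PartialSum X] (hX : IsWeak X) {x y : X} {ι : Type}
    [Countable ι] {n : ι → ℕ} {m : ℕ} {s : ι → X} (hs : ∀ i, s i ∈ sum (fun _ : Fin (n i) => x))
    (hy : y ∈ sum (fun _ : Fin m => x)) (hn : FinSum (fun i => (n i : ℤ)) m) : y ∈ sum s := by
  have h1 : FinSum (fun _ : Σ i, Fin (n i) => (1 : ℤ)) m := by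
    refine finSum_flattening _ (fun i => (n i : ℤ)) (fun i => ⟨Set.toFinite _, ?_⟩)
      (hn.1.subset ?_) hn
    · simp [finsum_eq_sum_of_fintype]
    · rintro i ⟨j, -⟩ hi
      have : n i = 0 := by simpa using hi
      exact (this ▸ j).elim0
  have hfin : Finite (Σ i, Fin (n i)) := by
    rw [← Set.finite_univ_iff]
    exact h1.1.subset fun _ _ => one_ne_zero
  let := Fintype.ofFinite (Σ i, Fin (n i))
  have hcard : Fintype.card (Σ i, Fin (n i)) = m := by
    have := h1.2
    rw [finsum_eq_sum_of_fintype] at this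
    simpa using this
  refine hX.bracketing (fun _ : Σ i, Fin (n i) => x) s hs y ?_
  rw [← mem_sum_reindex (Fintype.equivFinOfCardEq hcard)] at hy
  exact hy

theorem exists_sigmaHom_unit {k : Flavour} (X : SCat.{u} k) (x : X) :
    ∃ f : unitObj.{u} k → X, IsSigmaHom f ∧ f (unitOne k) = x := by
  by_cases hk : k = .group
  · subst hk
    have hG : IsSigmaGroup X := X.holds
    let := hG.addCommGroup
    refine ⟨fun n => unitVal n • x, fun {ι} _ a n hn => ?_, ?_⟩
    · rw [mem_sum_unitObj] at hn
      have hsupp : (fun i => unitVal (a i) • x).support.Finite :=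
        hn.1.subset fun i hi h0 => hi (by
          change unitVal (a i) • x = 0
          rw [show unitVal (a i) = 0 from h0, zero_smul])
      convert hG.toIsFinitelyTotal.finsum_mem_sum _ hsupp
      change unitVal n • x = _
      rw [← hn.2]
      -- Summable families of integers are finitely supported, so additivity of `n ↦ n • x`
      -- suffices.
      exact (zmultiplesHom X x).map_finsum hn.1
    · change unitVal _ • x = x
      rw [unitVal_unitOne, one_smul]
  · have hdom : ∀ n : unitObj.{u} k, (sum (fun _ : Fin (unitVal n).natAbs => x)).Dom := by
      intro n
      -- Without finite totality only zero or one copy of `x` occurs, and both families are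
      -- summable.
      have h01 : k = .finitelyTotal ∨ unitVal n = 0 ∨ unitVal n = 1 := by
        cases k
        · exact Or.inr n.down.2
        · exact Or.inr n.down.2
        · exact Or.inl rfl
        · exact absurd rfl hk
      rcases h01 with rfl | h | h
      · exact IsFinitelyTotal.summable_of_finite X.holds _
      · obtain ⟨z, hz⟩ := X.holds.isWeak.exists_isZero
        rw [h]
        exact Part.dom_iff_mem.2 ⟨z, (isZero_iff (fun _ : Fin 0 => x)).1 hz⟩
      · rw [h]
        exact Part.dom_iff_mem.2 ⟨x, X.holds.isWeak.mem_sum_of_unique fun _ : Fin 1 => x⟩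
    have hval : ∀ n : unitObj.{u} k, ((unitVal n).natAbs : ℤ) = unitVal n := fun n =>
      Int.natAbs_of_nonneg (unitVal_nonneg hk n)
    refine ⟨fun n => (PartialSum.sum _).get (hdom n), fun a n hn => ?_, ?_⟩
    · refine X.holds.isWeak.sum_multiples (fun i => Part.get_mem _) (Part.get_mem (hdom n)) ?_
      simpa only [hval] using (mem_sum_unitObj a n).1 hn
    · refine Part.get_eq_of_mem ?_ _
      rw [unitVal_unitOne]
      exact X.holds.isWeak.mem_sum_of_unique fun _ : Fin 1 => x

/-- A homomorphism from the unit to `[X, X]` with `1 ↦ id`, uncurried. -/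
theorem exists_unitAction {k : Flavour} (X : SCat.{u} k) :
    ∃ f : SigmaBilinear (unitObj.{u} k) X X, ∀ x, f (unitOne k) x = x := by
  obtain ⟨e, he, h1⟩ := exists_sigmaHom_unit (homObj X X (holds_sigmaHom X.holds)) (𝟙 X)
  refine ⟨⟨fun n => (e n).toFun, fun n => (e n).isSigmaHom, fun x =>
    IsSigmaHom.comp (g := fun f : SigmaHom X X => f x) (isInitialSum_eval.isSigmaHom x) he⟩, fun x => ?_⟩
  change (e (unitOne k)).toFun x = x
  rw [h1]
  rfl

end Unit

/-! ### Operations on `Σ`-bilinear functions -/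

namespace SigmaBilinear

section

variable {X Y Z V W : Type u} [PartialSum X] [PartialSum Y] [PartialSum Z] [PartialSum V]
  [PartialSum W]

/-- Exchange the arguments. -/
def flip (f : SigmaBilinear X Y Z) : SigmaBilinear Y X Z where
  toFun y x := f x y
  isSigmaHom_right := f.isSigmaHom_left
  isSigmaHom_left := f.isSigmaHom_right

/-- Precompose with a `Σ`-homomorphism in each argument. -/
def precomp (f : SigmaBilinear X Y Z) (g : SigmaHom V X) (h : SigmaHom W Y) :
    SigmaBilinear V W Z where
  toFun v w := f (g.toFun v) (h.toFun w)
  isSigmaHom_right _ := IsSigmaHom.comp (f.isSigmaHom_right _) h.isSigmaHom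
  isSigmaHom_left w := IsSigmaHom.comp (g := fun x => f x (h.toFun w)) (f.isSigmaHom_left _)
    g.isSigmaHom

/-- The trilinear function `(x, y, z) ↦ r x (q y z)`, curried in the last argument. -/
noncomputable def curryComp (q : SigmaBilinear Y Z V) (r : SigmaBilinear X V W) :
    SigmaBilinear X Y (SigmaHom Z W) where
  toFun x y := ⟨fun z => r x (q y z), IsSigmaHom.comp (r.isSigmaHom_right x) (q.isSigmaHom_right y)⟩
  isSigmaHom_right x _ _ a y hy := (mem_homSum _ _).2 fun z =>
    r.isSigmaHom_right x _ _ (q.isSigmaHom_left z a y hy)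
  isSigmaHom_left y _ _ a x hx := (mem_homSum _ _).2 fun z => r.isSigmaHom_left (q y z) a x hx

end

/-- Evaluation as a `Σ`-bilinear function. -/
noncomputable def eval (X Y : Type u) [PartialSum X] [PartialSum Y] :
    SigmaBilinear X (SigmaHom X Y) Y where
  toFun x f := f x
  isSigmaHom_right x := isInitialSum_eval.isSigmaHom x
  isSigmaHom_left f := f.isSigmaHom

end SigmaBilinear

namespace BilinearFrom.IsTensorProduct

variable {k : Flavour} {X Y : SCat.{u} k} {T : BilinearFrom X Y}

/-- The `Σ`-homomorphism on a tensor product that corresponds to a `Σ`-bilinear function. -/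
noncomputable def desc (hT : T.IsTensorProduct) {W : SCat.{u} k} (f : SigmaBilinear X Y W) :
    T.obj ⟶ W :=
  (hT W f).choose

@[simp]
theorem desc_map (hT : T.IsTensorProduct) {W : SCat.{u} k} (f : SigmaBilinear X Y W) (x : X)
    (y : Y) : hT.desc f (T.map x y) = f x y :=
  (hT W f).choose_spec.1 x y

/-- Stated for bare functions so that it applies to a morphism on an iterated tensor product with
one argument fixed. -/
theorem eq_of_isSigmaHom (hT : T.IsTensorProduct) {W : SCat.{u} k} {f g : T.obj → W}
    (hf : IsSigmaHom f) (hg : IsSigmaHom g) (h : ∀ x y, f (T.map x y) = g (T.map x y))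
    (t : T.obj) : f t = g t := by
  have hf' : (⟨f, hf⟩ : SigmaHom T.obj W) = (⟨g, hg⟩ : SigmaHom T.obj W) := by
    refine (hT W ⟨fun x y => g (T.map x y), fun x => hg.comp (T.map.isSigmaHom_right x),
      fun y => ?_⟩).unique (y₁ := ⟨f, hf⟩) (y₂ := ⟨g, hg⟩) h fun _ _ => rfl
    exact IsSigmaHom.comp (f := fun x => T.map x y) hg (T.map.isSigmaHom_left y)
  exact congrArg (fun e : SigmaHom T.obj W => e.toFun t) hf'

theorem hom_ext (hT : T.IsTensorProduct) {W : SCat.{u} k} {f g : T.obj ⟶ W}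
    (h : ∀ x y, f (T.map x y) = g (T.map x y)) : f = g :=
  SigmaHom.ext (funext (hT.eq_of_isSigmaHom f.isSigmaHom g.isSigmaHom h))

theorem isSigmaHom_map_left (T : BilinearFrom X Y) {W : SCat.{u} k} (f : T.obj ⟶ W) (y : Y) :
    IsSigmaHom (fun x => f (T.map x y)) :=
  IsSigmaHom.comp (f := fun x => T.map x y) f.isSigmaHom (T.map.isSigmaHom_left y)

theorem isSigmaHom_map_right (T : BilinearFrom X Y) {W : SCat.{u} k} (f : T.obj ⟶ W) (x : X) :
    IsSigmaHom (fun y => f (T.map x y)) :=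
  IsSigmaHom.comp (f := fun y => T.map x y) f.isSigmaHom (T.map.isSigmaHom_right x)

/-- Extend a trilinear function to a bilinear one on the tensor product of the first factors. -/
noncomputable def desc₃ (hT : T.IsTensorProduct) {Z W : SCat.{u} k}
    (f : SigmaBilinear X Y (SigmaHom Z W)) : SigmaBilinear T.obj Z W where
  toFun t := (show SigmaHom Z W from hT.desc (W := homObj Z W (holds_sigmaHom W.holds)) f t).toFun
  isSigmaHom_right _ := SigmaHom.isSigmaHom _
  isSigmaHom_left z := IsSigmaHom.comp (g := fun f : SigmaHom Z W => f z)
    (isInitialSum_eval.isSigmaHom z)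
    (hT.desc (W := homObj Z W (holds_sigmaHom W.holds)) f).isSigmaHom

@[simp]
theorem desc₃_map (hT : T.IsTensorProduct) {Z W : SCat.{u} k}
    (f : SigmaBilinear X Y (SigmaHom Z W)) (x : X) (y : Y) (z : Z) :
    hT.desc₃ f (T.map x y) z = f x y z :=
  congrArg (fun f : SigmaHom Z W => f.toFun z)
    (hT.desc_map (W := homObj Z W (holds_sigmaHom W.holds)) f x y)

end BilinearFrom.IsTensorProduct

open BilinearFrom BilinearFrom.IsTensorProduct

/-! ### The structure morphisms -/

section Structure

variable {k : Flavour} {T : (X Y : SCat.{u} k) → BilinearFrom X Y}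
  (hT : ∀ X Y, (T X Y).IsTensorProduct)

include hT in
theorem hom_ext₃ {X Y Z W : SCat.{u} k} {f g : (T (T X Y).obj Z).obj ⟶ W}
    (h : ∀ x y z, f ((T _ Z).map ((T X Y).map x y) z) = g ((T _ Z).map ((T X Y).map x y) z)) :
    f = g :=
  (hT _ _).hom_ext fun t z => (hT X Y).eq_of_isSigmaHom
    (f := fun t => f ((T _ Z).map t z)) (g := fun t => g ((T _ Z).map t z)) (isSigmaHom_map_left _ f z)
    (isSigmaHom_map_left _ g z) (fun x y => h x y z) t

include hT in
theorem hom_ext₃' {X Y Z W : SCat.{u} k} {f g : (T X (T Y Z).obj).obj ⟶ W}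
    (h : ∀ x y z, f ((T X _).map x ((T Y Z).map y z)) = g ((T X _).map x ((T Y Z).map y z))) :
    f = g :=
  (hT _ _).hom_ext fun x t => (hT Y Z).eq_of_isSigmaHom
    (f := fun t => f ((T X _).map x t)) (g := fun t => g ((T X _).map x t)) (isSigmaHom_map_right _ f x)
    (isSigmaHom_map_right _ g x) (fun y z => h x y z) t

include hT in
theorem hom_ext₄ {X Y Z V W : SCat.{u} k} {f g : (T (T (T X Y).obj Z).obj V).obj ⟶ W}
    (h : ∀ x y z v, f ((T _ V).map ((T _ Z).map ((T X Y).map x y) z) v) =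
      g ((T _ V).map ((T _ Z).map ((T X Y).map x y) z) v)) : f = g :=
  (hT _ _).hom_ext fun t v => by
    refine congrArg (fun e : SigmaHom _ W => e.toFun t) (hom_ext₃ hT
      (f := ⟨fun t => f ((T _ V).map t v), isSigmaHom_map_left _ f v⟩)
      (g := ⟨fun t => g ((T _ V).map t v), isSigmaHom_map_left _ g v⟩) ?_)
    exact fun x y z => h x y z v

/-- The tensor product of morphisms. -/
noncomputable def tensorMap {X Y Z W : SCat.{u} k} (f : X ⟶ Z) (g : Y ⟶ W) :
    (T X Y).obj ⟶ (T Z W).obj :=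
  (hT X Y).desc ((T Z W).map.precomp f g)

@[simp]
theorem tensorMap_map {X Y Z W : SCat.{u} k} (f : X ⟶ Z) (g : Y ⟶ W) (x : X) (y : Y) :
    tensorMap hT f g ((T X Y).map x y) = (T Z W).map (f x) (g y) :=
  desc_map _ _ x y

/-- The associator. -/
noncomputable def assocHom (X Y Z : SCat.{u} k) :
    (T (T X Y).obj Z).obj ⟶ (T X (T Y Z).obj).obj :=
  (hT _ _).desc ((hT X Y).desc₃ ((T Y Z).map.curryComp (T X (T Y Z).obj).map))

@[simp]
theorem assocHom_map (X Y Z : SCat.{u} k) (x : X) (y : Y) (z : Z) :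
    assocHom hT X Y Z ((T _ Z).map ((T X Y).map x y) z) =
      (T X _).map x ((T Y Z).map y z) :=
  (desc_map _ _ _ z).trans (desc₃_map _ _ x y z)

/-- The inverse of the associator. -/
noncomputable def assocInv (X Y Z : SCat.{u} k) :
    (T X (T Y Z).obj).obj ⟶ (T (T X Y).obj Z).obj :=
  -- `desc₃` extends over the first two arguments, so the flips make `x` the curried variable of
  -- `(x, y, z) ↦ (x ⊗ y) ⊗ z`.
  (hT _ _).desc ((hT Y Z).desc₃
    ((T X Y).map.flip.curryComp (T (T X Y).obj Z).map.flip).flip).flip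

@[simp]
theorem assocInv_map (X Y Z : SCat.{u} k) (x : X) (y : Y) (z : Z) :
    assocInv hT X Y Z ((T X _).map x ((T Y Z).map y z)) =
      (T _ Z).map ((T X Y).map x y) z :=
  (desc_map _ _ x _).trans (desc₃_map _ _ y z x)

/-- The braiding. -/
noncomputable def braidHom (X Y : SCat.{u} k) : (T X Y).obj ⟶ (T Y X).obj :=
  (hT X Y).desc (T Y X).map.flip

@[simp]
theorem braidHom_map (X Y : SCat.{u} k) (x : X) (y : Y) :
    braidHom hT X Y ((T X Y).map x y) = (T Y X).map y x :=
  desc_map _ _ x y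

/-- The action of the tensor unit on an object. -/
noncomputable def unitAction (X : SCat.{u} k) : SigmaBilinear (unitObj.{u} k) X X :=
  (exists_unitAction X).choose

@[simp]
theorem unitAction_unitOne (X : SCat.{u} k) (x : X) : unitAction X (unitOne k) x = x :=
  (exists_unitAction X).choose_spec x

theorem isMultiple_unitAction (X : SCat.{u} k) (n : unitObj.{u} k) (x : X) :
    IsMultiple (unitVal n) x (unitAction X n x) := by
  have := IsSigmaHom.map_isMultiple (f := fun n => unitAction X n x)
    ((unitAction X).isSigmaHom_left x) (isMultiple_unitOne n)
  simpa using this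

/-- Both sides are the `n`-fold multiple of `f x`, which is unique. -/
theorem map_unitAction {X Y : SCat.{u} k} (f : X ⟶ Y) (n : unitObj.{u} k) (x : X) :
    f (unitAction X n x) = unitAction Y n (f x) :=
  isMultiple_unique n (IsSigmaHom.map_isMultiple (f := f) f.isSigmaHom (isMultiple_unitAction X n x))
    (isMultiple_unitAction Y n (f x))

theorem map_unitAction_left {X Y : SCat.{u} k} (S : BilinearFrom X Y) (n : unitObj.{u} k) (x : X)
    (y : Y) : S.map (unitAction X n x) y = unitAction S.obj n (S.map x y) :=
  map_unitAction (X := X) (Y := S.obj) ⟨fun x => S.map x y, S.map.isSigmaHom_left y⟩ n x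

theorem map_unitAction_right {X Y : SCat.{u} k} (S : BilinearFrom X Y) (n : unitObj.{u} k) (x : X)
    (y : Y) : S.map x (unitAction Y n y) = unitAction S.obj n (S.map x y) :=
  map_unitAction (X := Y) (Y := S.obj) ⟨fun y => S.map x y, S.map.isSigmaHom_right x⟩ n y

theorem unitAction_unitOne_right (n : unitObj.{u} k) :
    unitAction (unitObj k) n (unitOne k) = n :=
  isMultiple_unique n (isMultiple_unitAction _ _ _) (isMultiple_unitOne n)

/-- The left unitor. -/
noncomputable def leftUnitorIso (X : SCat.{u} k) : (T (unitObj k) X).obj ≅ X where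
  hom := (hT _ _).desc (unitAction X)
  inv := (⟨fun x => (T (unitObj k) X).map (unitOne k) x, (T _ X).map.isSigmaHom_right _⟩ :
    SigmaHom _ _)
  hom_inv_id := (hT _ _).hom_ext fun n x => by
    change (T (unitObj k) X).map (unitOne k) ((hT _ _).desc (unitAction X) _) = _
    -- `1 ⊗ (n · x) = n · (1 ⊗ x) = (n · 1) ⊗ x = n ⊗ x`.
    rw [desc_map, map_unitAction_right, ← map_unitAction_left, unitAction_unitOne_right]
    rfl
  inv_hom_id := SigmaHom.ext <| funext fun x =>
    ((hT _ _).desc_map (unitAction X) _ x).trans (unitAction_unitOne X x)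

theorem leftUnitorIso_hom_map (X : SCat.{u} k) (n : unitObj.{u} k) (x : X) :
    (leftUnitorIso hT X).hom ((T _ X).map n x) = unitAction X n x :=
  desc_map _ _ n x

/-- The right unitor. -/
noncomputable def rightUnitorIso (X : SCat.{u} k) : (T X (unitObj k)).obj ≅ X where
  hom := (hT _ _).desc (unitAction X).flip
  inv := (⟨fun x => (T X (unitObj k)).map x (unitOne k), (T X _).map.isSigmaHom_left _⟩ :
    SigmaHom _ _)
  hom_inv_id := (hT _ _).hom_ext fun x n => by
    change (T X (unitObj k)).map ((hT _ _).desc (unitAction X).flip _) (unitOne k) = _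
    rw [desc_map]
    change (T X (unitObj k)).map (unitAction X n x) _ = _
    rw [map_unitAction_left, ← map_unitAction_right, unitAction_unitOne_right]
    rfl
  inv_hom_id := SigmaHom.ext <| funext fun x =>
    ((hT _ _).desc_map (unitAction X).flip x _).trans (unitAction_unitOne X x)

theorem rightUnitorIso_hom_map (X : SCat.{u} k) (x : X) (n : unitObj.{u} k) :
    (rightUnitorIso hT X).hom ((T X _).map x n) = unitAction X n x :=
  desc_map _ _ x n

/-- The associator as an isomorphism. -/
noncomputable def assocIso (X Y Z : SCat.{u} k) :
    (T (T X Y).obj Z).obj ≅ (T X (T Y Z).obj).obj where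
  hom := assocHom hT X Y Z
  inv := assocInv hT X Y Z
  hom_inv_id := hom_ext₃ hT fun x y z => by simp
  inv_hom_id := hom_ext₃' hT fun x y z => by simp

/-- The braiding as an isomorphism. -/
noncomputable def braidIso (X Y : SCat.{u} k) : (T X Y).obj ≅ (T Y X).obj where
  hom := braidHom hT X Y
  inv := braidHom hT Y X
  hom_inv_id := (hT _ _).hom_ext fun x y => by simp
  inv_hom_id := (hT _ _).hom_ext fun x y => by simp

/-! ### The closed symmetric monoidal category -/

/-- The monoidal category given by a choice of tensor products. -/
noncomputable abbrev monoidalCategory : MonoidalCategory (SCat.{u} k) :=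
  letI : MonoidalCategoryStruct (SCat.{u} k) :=
    { tensorObj := fun X Y => (T X Y).obj
      whiskerLeft := fun X _ _ f => tensorMap hT (𝟙 X) f
      whiskerRight := fun f Y => tensorMap hT f (𝟙 Y)
      tensorHom := fun f g => tensorMap hT f g
      tensorUnit := unitObj k
      associator := assocIso hT
      leftUnitor := leftUnitorIso hT
      rightUnitor := rightUnitorIso hT }
  MonoidalCategory.ofTensorHom
    (id_tensorHom_id := fun X Y => (hT _ _).hom_ext fun x y => tensorMap_map hT (𝟙 X) (𝟙 Y) x y)
    (id_tensorHom := fun _ _ _ _ => rfl)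
    (tensorHom_id := fun _ _ => rfl)
    (tensorHom_comp_tensorHom := fun f₁ f₂ g₁ g₂ =>
      show tensorMap hT f₁ f₂ ≫ tensorMap hT g₁ g₂ = tensorMap hT (f₁ ≫ g₁) (f₂ ≫ g₂) from
      (hT _ _).hom_ext fun x y => by simp)
    (associator_naturality := fun f₁ f₂ f₃ =>
      show tensorMap hT (tensorMap hT f₁ f₂) f₃ ≫ assocHom hT _ _ _ =
        assocHom hT _ _ _ ≫ tensorMap hT f₁ (tensorMap hT f₂ f₃) from
      hom_ext₃ hT fun x y z => by simp)
    (leftUnitor_naturality := fun {X Y} f =>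
      show tensorMap hT (𝟙 _) f ≫ (leftUnitorIso hT Y).hom = (leftUnitorIso hT X).hom ≫ f from
      (hT _ _).hom_ext fun n x => by simp [leftUnitorIso_hom_map, map_unitAction])
    (rightUnitor_naturality := fun {X Y} f =>
      show tensorMap hT f (𝟙 _) ≫ (rightUnitorIso hT Y).hom = (rightUnitorIso hT X).hom ≫ f from
      (hT _ _).hom_ext fun x n => by simp [rightUnitorIso_hom_map, map_unitAction])
    (pentagon := fun W X Y Z =>
      show tensorMap hT (assocHom hT W X Y) (𝟙 Z) ≫ assocHom hT W _ Z ≫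
          tensorMap hT (𝟙 W) (assocHom hT X Y Z) = assocHom hT _ Y Z ≫ assocHom hT W X _ from
      hom_ext₄ hT fun w x y z => by simp)
    (triangle := fun X Y =>
      show assocHom hT X _ Y ≫ tensorMap hT (𝟙 X) (leftUnitorIso hT Y).hom =
        tensorMap hT (rightUnitorIso hT X).hom (𝟙 Y) from
      -- Both sides become `n · (x ⊗ y)`.
      hom_ext₃ hT fun x n y => by
        simp [rightUnitorIso_hom_map, leftUnitorIso_hom_map, map_unitAction_left,
          map_unitAction_right])

/-- The symmetry given by a choice of tensor products. -/
noncomputable abbrev symmetricCategory :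
    letI := monoidalCategory hT
    SymmetricCategory (SCat.{u} k) :=
  letI := monoidalCategory hT
  { braiding := braidIso hT
    braiding_naturality_right := fun X Y Z f =>
      show tensorMap hT (𝟙 X) f ≫ braidHom hT X Z = braidHom hT X Y ≫ tensorMap hT f (𝟙 X) from
      (hT _ _).hom_ext fun x y => by simp
    braiding_naturality_left := fun {X Y} f Z =>
      show tensorMap hT f (𝟙 Z) ≫ braidHom hT Y Z = braidHom hT X Z ≫ tensorMap hT (𝟙 Z) f from
      (hT _ _).hom_ext fun x y => by simp
    hexagon_forward := fun X Y Z =>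
      show assocHom hT X Y Z ≫ braidHom hT X _ ≫ assocHom hT Y Z X =
        tensorMap hT (braidHom hT X Y) (𝟙 Z) ≫ assocHom hT Y X Z ≫
          tensorMap hT (𝟙 Y) (braidHom hT X Z) from
      hom_ext₃ hT fun x y z => by simp
    hexagon_reverse := fun X Y Z =>
      show assocInv hT X Y Z ≫ braidHom hT _ Z ≫ assocInv hT Z X Y =
        tensorMap hT (𝟙 X) (braidHom hT Y Z) ≫ assocInv hT X Z Y ≫
          tensorMap hT (braidHom hT X Z) (𝟙 Y) from
      hom_ext₃' hT fun x y z => by simp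
    symmetry := fun X Y => (braidIso hT X Y).hom_inv_id }

/-- The internal hom functor `[X, -]`. -/
noncomputable def homFunctor (X : SCat.{u} k) : SCat.{u} k ⥤ SCat.{u} k where
  obj Y := homObj X Y (holds_sigmaHom Y.holds)
  map {Y Z} g := (⟨fun f => (show X ⟶ Z from (show X ⟶ Y from f) ≫ g), fun _ _ hf =>
    (mem_homSum _ _).2 fun x => g.isSigmaHom _ _ ((mem_homSum _ _).1 hf x)⟩ :
      SigmaHom (SigmaHom X Y) (SigmaHom X Z))

/-- The evaluation morphism. -/
noncomputable def evalHom (X Y : SCat.{u} k) :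
    (T X (homObj X Y (holds_sigmaHom Y.holds))).obj ⟶ Y :=
  (hT _ _).desc (SigmaBilinear.eval X Y)

theorem evalHom_map (X Y : SCat.{u} k) (x : X) (f : SigmaHom X Y) :
    evalHom hT X Y ((T X (homObj X Y (holds_sigmaHom Y.holds))).map x f) = f x :=
  (hT X (homObj X Y (holds_sigmaHom Y.holds))).desc_map (SigmaBilinear.eval X Y) x f

/-- The coevaluation morphism. -/
noncomputable def coevalHom (T : (X Y : SCat.{u} k) → BilinearFrom X Y) (X Y : SCat.{u} k) :
    Y ⟶ homObj X (T X Y).obj (holds_sigmaHom (T X Y).obj.holds) :=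
  (⟨fun y => ⟨fun x => (T X Y).map x y, (T X Y).map.isSigmaHom_left y⟩, fun _ _ hy =>
    (mem_homSum _ _).2 fun x => (T X Y).map.isSigmaHom_right x _ _ hy⟩ :
      SigmaHom Y (SigmaHom X (T X Y).obj))

/-- The closed structure given by a choice of tensor products. -/
noncomputable abbrev monoidalClosed :
    letI := monoidalCategory hT
    MonoidalClosed (SCat.{u} k) :=
  letI := monoidalCategory hT
  { closed := fun X =>
    { rightAdj := homFunctor X
      adj :=
      { unit :=
        { app := fun Y => coevalHom T X Y
          naturality := fun _ _ f => SigmaHom.ext <| funext fun y => SigmaHom.ext <| funext fun x =>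
            (tensorMap_map hT (𝟙 X) f x y).symm }
        counit :=
        { app := fun Y => evalHom hT X Y
          naturality := fun Y Z f =>
            show tensorMap hT (𝟙 X) ((homFunctor X).map f) ≫ evalHom hT X Z =
              evalHom hT X Y ≫ f from
            (hT _ _).hom_ext fun x h =>
              (congrArg (fun t => evalHom hT X Z t)
                (tensorMap_map hT (𝟙 X) ((homFunctor X).map f) x h)).trans
              ((evalHom_map hT X Z x _).trans
                (congrArg (fun y => f y) (evalHom_map hT X Y x h)).symm) }
        left_triangle_components := fun Y =>
          show tensorMap hT (𝟙 X) (coevalHom T X Y) ≫ evalHom hT X (T X Y).obj = 𝟙 _ from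
          (hT _ _).hom_ext fun x y =>
            (congrArg (fun t => evalHom hT X (T X Y).obj t)
              (tensorMap_map hT (𝟙 X) (coevalHom T X Y) x y)).trans
            (evalHom_map hT X (T X Y).obj x _)
        right_triangle_components := fun Y => SigmaHom.ext <| funext fun h =>
          SigmaHom.ext <| funext fun x => evalHom_map hT X Y x h } } }

end Structure

end SigmaMonoid

theorem mainTheorem7 (k : SigmaMonoid.Flavour) :
    (∀ X Y : SigmaMonoid.SCat.{u} k,
      ∃ T : SigmaMonoid.BilinearFrom X Y, T.IsTensorProduct) ∧
    ∃ hH : ∀ X Y : SigmaMonoid.SCat.{u} k, k.Holds (SigmaMonoid.SigmaHom X Y),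
    ∀ T : (X Y : SigmaMonoid.SCat.{u} k) → SigmaMonoid.BilinearFrom X Y,
      (∀ X Y, (T X Y).IsTensorProduct) →
      ∃ (_ : MonoidalCategory (SigmaMonoid.SCat.{u} k))
        (_ : SymmetricCategory (SigmaMonoid.SCat.{u} k))
        (_ : MonoidalClosed (SigmaMonoid.SCat.{u} k))
        (p : (X Y : SigmaMonoid.SCat.{u} k) →
          SigmaMonoid.SigmaBilinear X Y (X ⊗ Y : SigmaMonoid.SCat.{u} k))
        (hI : 𝟙_ (SigmaMonoid.SCat.{u} k) = SigmaMonoid.unitObj.{u} k)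
        (hHom : ∀ X Y : SigmaMonoid.SCat.{u} k,
          (ihom X).obj Y = SigmaMonoid.homObj X Y (hH X Y)),
        -- the monoidal product on objects is the given tensor product
        (∀ X Y : SigmaMonoid.SCat.{u} k, SigmaMonoid.BilinearFrom.mk (X ⊗ Y) (p X Y) = T X Y) ∧
        -- the monoidal product on morphisms
        (∀ {X Y Z W : SigmaMonoid.SCat.{u} k} (f : X ⟶ Z) (g : Y ⟶ W) (x : X) (y : Y),
          (f ⊗ₘ g) (p X Y x y) = p Z W (f x) (g y)) ∧
        -- unitors
        (∀ (X : SigmaMonoid.SCat.{u} k) (n : SigmaMonoid.unitObj.{u} k) (x : X),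
          SigmaMonoid.IsMultiple (SigmaMonoid.unitVal n) x
            ((λ_ X).hom (p (𝟙_ _) X (eqToHom hI.symm n) x))) ∧
        (∀ (X : SigmaMonoid.SCat.{u} k) (n : SigmaMonoid.unitObj.{u} k) (x : X),
          SigmaMonoid.IsMultiple (SigmaMonoid.unitVal n) x
            ((ρ_ X).hom (p X (𝟙_ _) x (eqToHom hI.symm n)))) ∧
        -- associator
        (∀ (X Y Z : SigmaMonoid.SCat.{u} k) (x : X) (y : Y) (z : Z),
          (α_ X Y Z).hom (p (X ⊗ Y) Z (p X Y x y) z) = p X (Y ⊗ Z) x (p Y Z y z)) ∧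
        -- symmetry
        (∀ (X Y : SigmaMonoid.SCat.{u} k) (x : X) (y : Y),
          (β_ X Y).hom (p X Y x y) = p Y X y x) ∧
        -- the counit of the closed structure is evaluation
        (∀ (X Y : SigmaMonoid.SCat.{u} k) (x : X) (h : SigmaMonoid.SigmaHom X Y),
          (ihom.ev X).app Y (p X ((ihom X).obj Y) x
            (eqToHom (hHom X Y).symm h)) = h x) := by
  refine ⟨fun X Y => ⟨SigmaMonoid.tensor X Y, SigmaMonoid.isTensorProduct_tensor⟩,
    fun X Y => SigmaMonoid.holds_sigmaHom Y.holds, fun T hT => ?_⟩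
  -- Product, unit and internal hom are the prescribed ones definitionally, so the `eqToHom`
  -- transports are identities.
  refine ⟨SigmaMonoid.monoidalCategory hT, SigmaMonoid.symmetricCategory hT,
    SigmaMonoid.monoidalClosed hT, fun X Y => (T X Y).map, rfl, fun _ _ => rfl,
    fun _ _ => rfl, fun f g x y => SigmaMonoid.tensorMap_map hT f g x y, fun X n x => ?_,
    fun X n x => ?_, fun X Y Z x y z => SigmaMonoid.assocHom_map hT X Y Z x y z,
    fun X Y x y => SigmaMonoid.braidHom_map hT X Y x y,
    fun X Y x h => SigmaMonoid.evalHom_map hT X Y x h⟩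
  · convert SigmaMonoid.isMultiple_unitAction X n x using 1
    exact SigmaMonoid.leftUnitorIso_hom_map hT X n x
  · convert SigmaMonoid.isMultiple_unitAction X n x using 1
    exact SigmaMonoid.rightUnitorIso_hom_map hT X x n
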